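/- Let $\alpha<1$, $\beta>0$, $\lambda>0$, $\tau>0$ and $\tilde\theta\in\mathbb R$. All distributions below are conditional on the realization $\tilde\theta$ of a public signal. Consider a joint law of real random variables $(a_i,A,\theta)$: an agent's action, the aggregate action and the state. Call $\alpha A+\beta\theta$ the target. The action $a_i$ is a *direct signal* about the target if its conditional distribution given $(A,\theta)$ depends on $(A,\theta)$ only through $\alpha A+\beta\theta$. Given the law of $(A,\theta)$, it is *optimal* if it maximizes $$-\mathrm E\big[(a_i-(\alpha A+\beta\theta))^2\big]-\lambda\, I(\alpha A+\beta\theta;a_i)$$ among all direct signals about the target, of arbitrary distribution, where $I$ denotes mutual information. A joint law of $(a_i,A,\theta)$ is an *equilibrium* if 1. $(a_i,A,\theta)$ is jointly normal (possibly degenerate) with $\mathrm E[\theta]=\tilde\theta$ and $\mathrm{var}[\theta]=1/\tau$; 2. $a_i$ is an optimal direct signal; 3. $\mathrm E[a_i]=\mathrm E[A]$, $\mathrm{var}[A]=\mathrm{cov}[a_i,A]$ and $\mathrm{cov}[A,\theta]=\mathrm{cov}[a_i,\theta]$. The information fraction of an equilibrium is $\gamma=\mathrm{var}[a_i]/\mathrm{var}[\alpha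 A+\beta\theta]$. Put $$f(\gamma)=\frac{2\beta^2}{\lambda}\cdot\frac{1-\gamma}{(1-\alpha\gamma)^2}.$$ For each $\gamma>0$, there exists an equilibrium with information fraction $\gamma$ if and only if $\tau=f(\gamma)$; in particular, there exists an equilibrium with positive information fraction if and only if $\tau=f(\gamma)$ for some $\gamma>0$. There exists an equilibrium with $\gamma=0$ if and only if $\tau\ge f(0)$. Moreover: (i) If $\alpha\le 1/2$, there is exactly one equilibrium; it has $\gamma>0$ if $\tau<f(0)$ and $\gamma=0$ if $\tau\ge f(0)$. (ii) Suppose $\alpha>1/2$. (a) If $\tau<f(0)$ or $\tau>f((2\alpha-1)/\alpha)$, there is exactly one equilibrium; it has $\gamma>0$ in the former case and $\gamma=0$ in the latter. (b) If $\tau=f(0)$ or $\tau=f((2\alpha-1)/\alpha)$, there are exactly two equilibria, and $\gamma=0$ in exactly one of them. (c) If $f(0)<\tau<f((2\alpha-1)/\alpha)$, there are exactly three equilibria, and $\gamma=0$ in exactly one of them. In every equilibrium, $\mathrm E[a_i]=\mathrm E[A]=\beta\tilde\theta/(1-\alpha)$. In every equilibrium whose information fraction $\gamma$ satisfies $\tau=f(\gamma)$,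 $$A-\mathrm E[A]=\frac{\beta\gamma(\theta-\tilde\theta)}{1-\alpha\gamma}\ \text{ almost surely},\qquad \mathrm{var}[a_i]=\frac{\lambda\gamma}{2(1-\gamma)},$$ $$\mathrm{cov}[a_i,A]=\mathrm{var}[A]=\gamma\,\mathrm{var}[a_i]=\frac{\lambda\gamma^2}{2(1-\gamma)},$$ $$\mathrm{cov}[a_i,\theta]=\mathrm{cov}[A,\theta]=\frac{\mathrm{var}[a_i]-\alpha\,\mathrm{cov}[a_i,A]}{\beta}=\frac{\lambda\gamma(1-\alpha\gamma)}{2\beta(1-\gamma)}.$$ -/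

import Mathlib

open MeasureTheory ProbabilityTheory
open scoped ENNReal

namespace LQG

noncomputable section

/-- An outcome of the second-period subgame is a triple `(a_i, A, θ)`: the action of an agent, the
aggregate action, and the state. Its law is a measure on this space; everything is conditional on a
given realization of the public signal. -/
abbrev Outcome : Type := ℝ × ℝ × ℝ

/-- The agent's own action `a_i`. -/
def act (ω : Outcome) : ℝ := ω.1

/-- The aggregate action `A`. -/
def agg (ω : Outcome) : ℝ := ω.2.1

/-- The state `θ`. -/
def state (ω : Outcome) : ℝ := ω.2.2

/-- The target `α A + β θ` as a function of `(A, θ)`. -/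
def targetFn (α β : ℝ) (p : ℝ × ℝ) : ℝ := α * p.1 + β * p.2

theorem measurable_targetFn (α β : ℝ) : Measurable (targetFn α β) := by
  unfold targetFn
  fun_prop

/-- The target `α A + β θ` as a random variable on outcomes. -/
def target (α β : ℝ) (ω : Outcome) : ℝ := α * agg ω + β * state ω

/-- The mutual information `I(X; Y)` under `μ`: the Kullback-Leibler divergence of the joint law of
`(X, Y)` from the product of the marginal laws (equal to `∞` if it is not absolutely continuous). -/
def mutualInfo {Ω : Type*} [MeasurableSpace Ω] (μ : Measure Ω) (X Y : Ω → ℝ) : ℝ≥0∞ :=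
  InformationTheory.klDiv (μ.map fun ω => (X ω, Y ω)) ((μ.map X).prod (μ.map Y))

/-- The cost `λ · I(α A + β θ; a_i)` of the direct signal `a_i`. -/
def infoCost (α β lam : ℝ) (μ : Measure Outcome) : ℝ≥0∞ :=
  ENNReal.ofReal lam * mutualInfo μ (target α β) act

/-- The mean squared distance `E[(a_i - (α A + β θ))²]` of the action from the target. -/
def quadLoss (α β : ℝ) (μ : Measure Outcome) : ℝ≥0∞ :=
  ∫⁻ ω, ENNReal.ofReal ((act ω - target α β ω) ^ 2) ∂μ

/-- The agent's objective `-E[(a_i - (α A + β θ))²] - λ · I(α A + β θ; a_i)`. Both terms are at most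
zero, and the value is `-∞` if the loss or the cost is infinite. -/
def objective (α β lam : ℝ) (μ : Measure Outcome) : EReal :=
  -(quadLoss α β μ : EReal) - (infoCost α β lam μ : EReal)

/-- Under `μ`, the action `a_i` is a (possibly noisy) signal about the target `α A + β θ`: it is
drawn from a distribution that depends on `(A, θ)` only through the target. In other words, `a_i`
and `(A, θ)` are conditionally independent given `α A + β θ`. -/
def IsTargetSignal (α β : ℝ) (μ : Measure Outcome) : Prop :=
  ∃ κ : Kernel ℝ ℝ, IsMarkovKernel κ ∧
    μ = ((μ.map Prod.snd) ⊗ₘ (κ.comap (targetFn α β) (measurable_targetFn α β))).map Prod.swap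

/-- Under `μ`, the action `a_i` is an optimal direct signal: it is a signal about the target, and it
maximizes the objective among all signals about the target, with arbitrary distribution, the law of
`(A, θ)` being given. -/
def IsOptimalSignal (α β lam : ℝ) (μ : Measure Outcome) : Prop :=
  IsTargetSignal α β μ ∧
    ∀ μ' : Measure Outcome, IsProbabilityMeasure μ' → IsTargetSignal α β μ' →
      μ'.map Prod.snd = μ.map Prod.snd → objective α β lam μ' ≤ objective α β lam μ

/-- Symmetric Gaussian equilibrium of the second-period subgame, given the public signal `m` and the
precision `τ`. Gaussian laws may be degenerate. -/
structure IsEquilibrium (α β lam τ m : ℝ) (μ : Measure Outcome) : Prop where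
  gaussian : IsGaussian μ
  mean_state : ∫ ω, state ω ∂μ = m
  var_state : Var[state; μ] = 1 / τ
  optimal : IsOptimalSignal α β lam μ
  mean_eq : ∫ ω, act ω ∂μ = ∫ ω, agg ω ∂μ
  var_agg : Var[agg; μ] = cov[act, agg; μ]
  cov_state : cov[agg, state; μ] = cov[act, state; μ]

/-- The set of equilibria (as joint laws). -/
def equilibria (α β lam τ m : ℝ) : Set (Measure Outcome) :=
  {μ | IsEquilibrium α β lam τ m μ}

/-- The information fraction `γ = var[a_i] / var[α A + β θ]`. -/
def infoFraction (α β : ℝ) (μ : Measure Outcome) : ℝ :=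
  Var[act; μ] / Var[target α β; μ]

/-- `f(γ) = (2β²/λ) (1 - γ) / (1 - αγ)²`. -/
def f (α β lam γ : ℝ) : ℝ :=
  2 * β ^ 2 / lam * ((1 - γ) / (1 - α * γ) ^ 2)

end

end LQG

/-!
Given a Gaussian target of variance `v`, the Donsker–Varadhan inequality shows that an action whose
best affine prediction of the target leaves residual variance `r` carries information at least
`log (v / r) / 2`. Hence squared loss plus `lam` times information is at least
`r + lam / 2 * log (v / r)`, whose only minimizer on `(0, v]` is `r = min v (lam / 2)`. A Gaussian
signal attains this bound, and equality forces the mean and the variance of an optimal action and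
its covariance with the target.

Conditional independence of the action and the pair `(A, θ)` given the target, together with joint
normality, makes every covariance of the action proportional to the corresponding covariance of the
target, with factor the information fraction `γ`. All first and second moments of an equilibrium,
hence its law, are therefore determined by `γ`. The remaining condition on `γ` is a fixed-point
equation whose positive solutions are the roots in `(0, 1)` of `τ (1 - α γ)² = f(0) (1 - γ)`. Since
the right side minus the left side has sign `f(0) - τ` at `0` and is negative at `1`, the
intermediate value theorem and Vieta's formulas count these roots.
-/

namespace LQG

open InformationTheory
open scoped NNReal

section Information

variable {Ω : Type*} [MeasurableSpace Ω]

/- Donsker–Varadhan: Gibbs' inequality for `P` and the tilted measure `Q.tilted F`. -/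
theorem integral_sub_log_integral_exp_le_toReal_klDiv {P Q : Measure Ω} [IsProbabilityMeasure P]
    [IsProbabilityMeasure Q] {F : Ω → ℝ} (hP : Integrable F P)
    (hQ : Integrable (fun x => Real.exp (F x)) Q) (hPQ : klDiv P Q ≠ ∞) :
    ∫ x, F x ∂P - Real.log (∫ x, Real.exp (F x) ∂Q) ≤ (klDiv P Q).toReal := by
  obtain ⟨hac, hint⟩ := klDiv_ne_top_iff.1 hPQ
  have := isProbabilityMeasure_tilted hQ
  have gibbs := integral_llr_add_sub_measure_univ_nonneg
    (hac.trans (absolutelyContinuous_tilted hQ)) (integrable_llr_tilted_right hac hP hint hQ)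
  rw [integral_llr_tilted_right hac hP hQ hint, probReal_univ, probReal_univ] at gibbs
  rw [toReal_klDiv_of_measure_eq hac (by simp)]
  linarith

theorem klDiv_withDensity_exp {P Q : Measure Ω} [IsProbabilityMeasure P] [IsProbabilityMeasure Q]
    {F : Ω → ℝ} (hFm : Measurable F) (hPQ : P = Q.withDensity fun x => .ofReal (Real.exp (F x)))
    (hF : Integrable F P) : klDiv P Q = .ofReal (∫ x, F x ∂P) := by
  have hac : P ≪ Q := hPQ ▸ withDensity_absolutelyContinuous _ _
  have hrn := Measure.rnDeriv_withDensity Q hFm.exp.ennreal_ofReal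
  rw [← hPQ] at hrn
  have hllr : llr P Q =ᵐ[P] F := by
    filter_upwards [hac.ae_le hrn] with x hx
    rw [llr, hx, ENNReal.toReal_ofReal (Real.exp_pos _).le, Real.log_exp]
  rw [klDiv_of_ac_of_integrable hac ((integrable_congr hllr).2 hF), integral_congr_ae hllr]
  simp

theorem mutualInfo_comm {μ : Measure Ω} [IsFiniteMeasure μ] {X Y : Ω → ℝ}
    (hX : AEMeasurable X μ) (hY : AEMeasurable Y μ) : mutualInfo μ X Y = mutualInfo μ Y X := by
  have le {X Y : Ω → ℝ} (hX : AEMeasurable X μ) (hY : AEMeasurable Y μ) :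
      mutualInfo μ Y X ≤ mutualInfo μ X Y := by
    have h := klDiv_map_le (μ.map fun ω => (X ω, Y ω)) ((μ.map X).prod (μ.map Y)) measurable_swap
    rwa [Measure.prod_swap, AEMeasurable.map_map_of_aemeasurable (by fun_prop) (by fun_prop)] at h
  exact le_antisymm (le hY hX) (le hX hY)

/-- The logarithm of the ratio of the densities at `x` of the Gaussian laws `N(a, D)` and `N(m, v)`
(for `v, D ≠ 0`). -/
noncomputable def gaussianLogRatio (m : ℝ) (v : ℝ≥0) (a : ℝ) (D : ℝ≥0) (x : ℝ) : ℝ :=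
  1 / 2 * Real.log (v / D) - (x - a) ^ 2 / (2 * D) + (x - m) ^ 2 / (2 * v)

variable {m a : ℝ} {v D : ℝ≥0}

theorem measurable_gaussianLogRatio (m : ℝ) (v D : ℝ≥0) {a X : Ω → ℝ} (ha : Measurable a)
    (hX : Measurable X) : Measurable fun ω => gaussianLogRatio m v (a ω) D (X ω) := by
  unfold gaussianLogRatio
  fun_prop

theorem gaussianPDFReal_mul_exp_gaussianLogRatio (hv : v ≠ 0) (hD : D ≠ 0) (x : ℝ) :
    gaussianPDFReal m v x * Real.exp (gaussianLogRatio m v a D x) = gaussianPDFReal a D x := by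
  have hv' : (0 : ℝ) < v := by positivity
  have : (0 : ℝ) < D := by positivity
  have exp_half_log : Real.exp (1 / 2 * Real.log (v / D)) = √v / √D := by
    rw [← Real.sqrt_div hv'.le, Real.sqrt_eq_rpow, Real.rpow_def_of_pos (by positivity), mul_comm]
  simp only [gaussianPDFReal, gaussianLogRatio]
  rw [Real.exp_add, Real.exp_sub, exp_half_log, neg_div, neg_div, Real.exp_neg, Real.exp_neg,
    Real.sqrt_mul (by positivity) (v : ℝ), Real.sqrt_mul (by positivity) (D : ℝ)]
  field_simp

theorem withDensity_exp_gaussianLogRatio (hv : v ≠ 0) (hD : D ≠ 0) :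
    (gaussianReal m v).withDensity
      (fun x => .ofReal (Real.exp (gaussianLogRatio m v a D x))) = gaussianReal a D := by
  have hm : Measurable fun x => ENNReal.ofReal (Real.exp (gaussianLogRatio m v a D x)) :=
    (measurable_gaussianLogRatio m v D measurable_const measurable_id).exp.ennreal_ofReal
  rw [gaussianReal_of_var_ne_zero _ hv, gaussianReal_of_var_ne_zero _ hD,
    ← withDensity_mul _ (measurable_gaussianPDF m v) hm]
  congr with x
  simp only [Pi.mul_apply, gaussianPDF]
  rw [← ENNReal.ofReal_mul (gaussianPDFReal_nonneg _ _ _),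
    gaussianPDFReal_mul_exp_gaussianLogRatio hv hD]

theorem prod_gaussianReal_withDensity_exp (ρ : Measure Ω) [SFinite ρ] {a : Ω → ℝ}
    (ha : Measurable a) (hv : v ≠ 0) (hD : D ≠ 0) :
    (ρ.prod (gaussianReal m v)).withDensity
        (fun z => .ofReal (Real.exp (gaussianLogRatio m v (a z.1) D z.2)))
      = (ρ.prod (gaussianReal 0 D)).map fun z => (z.1, a z.1 + z.2) := by
  have hF : Measurable fun z : Ω × ℝ =>
      ENNReal.ofReal (Real.exp (gaussianLogRatio m v (a z.1) D z.2)) :=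
    (measurable_gaussianLogRatio m v D (by fun_prop) (by fun_prop)).exp.ennreal_ofReal
  have hT : Measurable fun z : Ω × ℝ => (z.1, a z.1 + z.2) := by fun_prop
  ext S hS
  rw [Measure.map_apply hT hS, Measure.prod_apply (hT hS), withDensity_apply _ hS,
    ← lintegral_indicator hS, lintegral_prod _ (hF.indicator hS).aemeasurable]
  refine lintegral_congr fun x => ?_
  have hSx : MeasurableSet (Prod.mk x ⁻¹' S) := measurable_prodMk_left hS
  calc
    _ = ∫⁻ y in Prod.mk x ⁻¹' S, .ofReal (Real.exp (gaussianLogRatio m v (a x) D y))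
          ∂gaussianReal m v := (lintegral_indicator hSx _)
    _ = gaussianReal (a x) D (Prod.mk x ⁻¹' S) := by
      rw [← withDensity_apply _ hSx, withDensity_exp_gaussianLogRatio hv hD]
    _ = (gaussianReal 0 D).map (a x + ·) (Prod.mk x ⁻¹' S) := by
      rw [gaussianReal_map_const_add, zero_add]
    _ = _ := Measure.map_apply (by fun_prop) hSx

section

variable {μ : Measure Ω} {X Y : Ω → ℝ}

theorem memLp_two_of_hasLaw_gaussianReal (hX : HasLaw X (gaussianReal m v) μ) : MemLp X 2 μ := by
  have h := memLp_id_gaussianReal' (μ := m) (v := v) 2 (by simp)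
  rwa [← hX.map_eq, memLp_map_measure_iff (by fun_prop) hX.aemeasurable] at h

theorem integral_sub_mean_sq_of_hasLaw_gaussianReal (hX : HasLaw X (gaussianReal m v) μ) :
    ∫ ω, (X ω - m) ^ 2 ∂μ = v := by
  have h := hX.variance_eq
  rwa [variance_eq_integral hX.aemeasurable, hX.integral_eq, variance_id_gaussianReal,
    integral_id_gaussianReal] at h

variable [IsProbabilityMeasure μ] {a : Ω → ℝ}

theorem integrable_gaussianLogRatio (v D : ℝ≥0) (hX : MemLp (fun ω => X ω - m) 2 μ)
    (hXa : MemLp (fun ω => X ω - a ω) 2 μ) :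
    Integrable (fun ω => gaussianLogRatio m v (a ω) D (X ω)) μ :=
  ((integrable_const _).sub (hXa.integrable_sq.div_const _)).add (hX.integrable_sq.div_const _)

theorem integral_gaussianLogRatio (D : ℝ≥0) (hv : v ≠ 0) (hX : HasLaw X (gaussianReal m v) μ)
    (hXa : MemLp (fun ω => X ω - a ω) 2 μ) :
    ∫ ω, gaussianLogRatio m v (a ω) D (X ω) ∂μ
      = 1 / 2 * Real.log (v / D) - (∫ ω, (X ω - a ω) ^ 2 ∂μ) / (2 * D) + 1 / 2 := by
  have hXm := ((memLp_two_of_hasLaw_gaussianReal hX).sub (memLp_const m)).integrable_sq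
  have hXa' := hXa.integrable_sq.div_const (2 * (D : ℝ))
  have hlogXa : Integrable
      (fun ω => 1 / 2 * Real.log (v / D) - (X ω - a ω) ^ 2 / (2 * (D : ℝ))) μ :=
    (integrable_const _).sub hXa'
  simp only [Pi.sub_apply] at hXm
  simp only [gaussianLogRatio]
  rw [integral_add hlogXa (hXm.div_const _),
    integral_sub (integrable_const _) hXa', integral_div, integral_div,
    integral_sub_mean_sq_of_hasLaw_gaussianReal hX, integral_const, probReal_univ, one_smul]
  field_simp

theorem le_toReal_mutualInfo_of_predictor (hv : v ≠ 0) (hX : HasLaw X (gaussianReal m v) μ)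
    (hY : AEMeasurable Y μ) (hI : mutualInfo μ X Y ≠ ∞) {g : ℝ → ℝ} (hg : Measurable g)
    (hXg : MemLp (fun ω => X ω - g (Y ω)) 2 μ) (hD : D ≠ 0) :
    1 / 2 * Real.log (v / D) - (∫ ω, (X ω - g (Y ω)) ^ 2 ∂μ) / (2 * D) + 1 / 2
      ≤ (mutualInfo μ X Y).toReal := by
  have hXm := hX.aemeasurable
  have := Measure.isProbabilityMeasure_map (μ := μ) hY
  have := Measure.isProbabilityMeasure_map (μ := μ) (f := fun ω => (Y ω, X ω)) (by fun_prop)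
  rw [mutualInfo_comm hXm hY, mutualInfo, hX.map_eq] at hI ⊢
  set Q := (μ.map Y).prod (gaussianReal m v)
  set F : ℝ × ℝ → ℝ := fun z => gaussianLogRatio m v (g z.1) D z.2
  have hFm : Measurable F := measurable_gaussianLogRatio _ _ _ (by fun_prop) (by fun_prop)
  have lintegral_exp : ∫⁻ z, .ofReal (Real.exp (F z)) ∂Q = 1 := by
    have := Measure.isProbabilityMeasure_map (μ := (μ.map Y).prod (gaussianReal 0 D))
      (f := fun z => (z.1, g z.1 + z.2)) (by fun_prop)
    rw [← setLIntegral_univ, ← withDensity_apply _ .univ,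
      prod_gaussianReal_withDensity_exp _ hg hv hD, measure_univ]
  have hFQ : Integrable (fun z => Real.exp (F z)) Q := by
    refine ⟨hFm.exp.aestronglyMeasurable, ?_⟩
    rw [hasFiniteIntegral_iff_ofReal (.of_forall fun z => (Real.exp_pos _).le), lintegral_exp]
    exact ENNReal.one_lt_top
  have integral_exp : ∫ z, Real.exp (F z) ∂Q = 1 := by
    rw [integral_eq_lintegral_of_nonneg_ae (.of_forall fun z => (Real.exp_pos _).le)
      hFm.exp.aestronglyMeasurable, lintegral_exp, ENNReal.toReal_one]
  have hFP : Integrable F (μ.map fun ω => (Y ω, X ω)) :=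
    (integrable_map_measure hFm.aestronglyMeasurable (by fun_prop)).2 <|
      integrable_gaussianLogRatio v D
        ((memLp_two_of_hasLaw_gaussianReal hX).sub (memLp_const m)) hXg
  have dv := integral_sub_log_integral_exp_le_toReal_klDiv hFP hFQ hI
  rwa [integral_exp, Real.log_one, sub_zero, integral_map (by fun_prop) hFm.aestronglyMeasurable,
    integral_gaussianLogRatio D hv hX hXg] at dv

end

theorem klDiv_prod_map_add_noise {ρ : Measure Ω} [IsProbabilityMeasure ρ] {a : Ω → ℝ}
    (ha : Measurable a) (hv : v ≠ 0) (hD : D ≠ 0)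
    (hX : HasLaw (fun z => a z.1 + z.2) (gaussianReal m v) (ρ.prod (gaussianReal 0 D))) :
    klDiv ((ρ.prod (gaussianReal 0 D)).map fun z => (z.1, a z.1 + z.2))
      (ρ.prod (gaussianReal m v)) = .ofReal (1 / 2 * Real.log (v / D)) := by
  set ξ := ρ.prod (gaussianReal 0 D)
  have hT : Measurable fun z : Ω × ℝ => (z.1, a z.1 + z.2) := by fun_prop
  have := Measure.isProbabilityMeasure_map (μ := ξ) hT.aemeasurable
  have hF : Measurable fun z : Ω × ℝ => gaussianLogRatio m v (a z.1) D z.2 :=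
    measurable_gaussianLogRatio _ _ _ (by fun_prop) (by fun_prop)
  have noise : HasLaw (fun z : Ω × ℝ => z.2) (gaussianReal 0 D) ξ :=
    measurePreserving_snd.hasLaw
  have hXa : MemLp (fun z : Ω × ℝ => a z.1 + z.2 - a z.1) 2 ξ := by
    simpa only [add_sub_cancel_left] using memLp_two_of_hasLaw_gaussianReal noise
  have residual : ∫ z, (a z.1 + z.2 - a z.1) ^ 2 ∂ξ = D := by
    simpa only [add_sub_cancel_left, sub_zero] using
      integral_sub_mean_sq_of_hasLaw_gaussianReal noise
  have hFP : Integrable (fun z => gaussianLogRatio m v (a z.1) D z.2)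
      (ξ.map fun z => (z.1, a z.1 + z.2)) :=
    (integrable_map_measure hF.aestronglyMeasurable hT.aemeasurable).2 <|
      integrable_gaussianLogRatio v D
        ((memLp_two_of_hasLaw_gaussianReal hX).sub (memLp_const m)) hXa
  rw [klDiv_withDensity_exp hF (prod_gaussianReal_withDensity_exp ρ ha hv hD).symm hFP,
    integral_map hT.aemeasurable hF.aestronglyMeasurable, integral_gaussianLogRatio D hv hX hXa,
    residual]
  congr 1
  field_simp
  ring

end Information

section Regression

variable {Ω : Type*} [MeasurableSpace Ω] {μ : Measure Ω} {X Y : Ω → ℝ}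

/-- The residual variance of the linear regression of `X` on `Y`. Division by zero makes it `Var X`
when `Y` is constant. -/
noncomputable def residualVariance (μ : Measure Ω) (X Y : Ω → ℝ) : ℝ :=
  Var[X; μ] - cov[Y, X; μ] ^ 2 / Var[Y; μ]

theorem residualVariance_le_variance : residualVariance μ X Y ≤ Var[X; μ] :=
  sub_le_self _ (div_nonneg (sq_nonneg _) (variance_nonneg Y μ))

variable [IsProbabilityMeasure μ]

theorem variance_sub_mul (hX : MemLp X 2 μ) (hY : MemLp Y 2 μ) (b : ℝ) :
    Var[fun ω => X ω - b * Y ω; μ] = Var[X; μ] - 2 * b * cov[Y, X; μ] + b ^ 2 * Var[Y; μ] := by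
  rw [variance_fun_sub hX (hY.const_mul b), covariance_const_mul_right, variance_const_mul,
    covariance_comm]
  ring

theorem integral_sq_eq_variance_add_sq (hX : MemLp X 2 μ) :
    ∫ ω, X ω ^ 2 ∂μ = Var[X; μ] + (∫ ω, X ω ∂μ) ^ 2 := by
  rw [variance_eq_sub hX]
  simp

theorem covariance_sq_le (hX : MemLp X 2 μ) (hY : MemLp Y 2 μ) :
    cov[Y, X; μ] ^ 2 ≤ Var[X; μ] * Var[Y; μ] := by
  have nonneg (b : ℝ) : 0 ≤ Var[Y; μ] * (b * b) + -2 * cov[Y, X; μ] * b + Var[X; μ] := by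
    have h := variance_nonneg (fun ω => X ω - b * Y ω) μ
    rw [variance_sub_mul hX hY] at h
    linarith
  have h := discrim_le_zero nonneg
  rw [discrim] at h
  linarith

theorem covariance_eq_zero_of_variance_eq_zero (hX : MemLp X 2 μ) (hY : MemLp Y 2 μ)
    (h : Var[Y; μ] = 0) : cov[Y, X; μ] = 0 := by
  have hsq := covariance_sq_le hX hY
  rw [h, mul_zero] at hsq
  exact pow_eq_zero_iff two_ne_zero |>.1 (le_antisymm hsq (sq_nonneg _))

theorem residualVariance_nonneg (hX : MemLp X 2 μ) (hY : MemLp Y 2 μ) :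
    0 ≤ residualVariance μ X Y :=
  sub_nonneg.2 <|
    div_le_of_le_mul₀ (variance_nonneg Y μ) (variance_nonneg X μ) (covariance_sq_le hX hY)

theorem memLp_sub_regression (hX : MemLp X 2 μ) (hY : MemLp Y 2 μ) (b c : ℝ) :
    MemLp (fun ω => X ω - (c + b * Y ω)) 2 μ :=
  hX.sub ((memLp_const c).add (hY.const_mul b))

theorem exists_regression (hX : MemLp X 2 μ) (hY : MemLp Y 2 μ) :
    ∃ b c : ℝ, ∫ ω, (X ω - (c + b * Y ω)) ^ 2 ∂μ = residualVariance μ X Y := by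
  set b := cov[Y, X; μ] / Var[Y; μ] with hb
  set c := (∫ ω, X ω ∂μ) - b * ∫ ω, Y ω ∂μ
  have hbY := hY.const_mul b
  have hXbY : MemLp (fun ω => X ω - b * Y ω) 2 μ := hX.sub hbY
  have residual_eq (ω : Ω) : X ω - (c + b * Y ω) = X ω - b * Y ω - c := by ring
  have variance_eq : Var[fun ω => X ω - (c + b * Y ω); μ]
      = Var[X; μ] - 2 * b * cov[Y, X; μ] + b ^ 2 * Var[Y; μ] := by
    simp only [residual_eq]
    rw [variance_sub_const hXbY.aestronglyMeasurable, variance_sub_mul hX hY]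
  have mean_eq : ∫ ω, X ω - (c + b * Y ω) ∂μ = 0 := by
    simp only [residual_eq]
    rw [integral_sub (hXbY.integrable one_le_two) (integrable_const c),
      integral_sub (hX.integrable one_le_two) (hbY.integrable one_le_two), integral_const_mul]
    simp [c]
  refine ⟨b, c, ?_⟩
  rw [integral_sq_eq_variance_add_sq (memLp_sub_regression hX hY b c), mean_eq, variance_eq,
    residualVariance, hb]
  rcases eq_or_ne Var[Y; μ] 0 with hw | hw
  · simp [hw]
  · field_simp
    ring

theorem integral_sub_sq_eq_residualVariance_add (hX : MemLp X 2 μ) (hY : MemLp Y 2 μ) :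
    ∫ ω, (Y ω - X ω) ^ 2 ∂μ = residualVariance μ X Y + (∫ ω, Y ω ∂μ - ∫ ω, X ω ∂μ) ^ 2
      + (Var[Y; μ] - cov[Y, X; μ]) ^ 2 / Var[Y; μ] := by
  have hYX : MemLp (fun ω => Y ω - X ω) 2 μ := hY.sub hX
  rw [integral_sq_eq_variance_add_sq hYX, variance_fun_sub hY hX,
    integral_sub (hY.integrable one_le_two) (hX.integrable one_le_two), residualVariance]
  rcases eq_or_ne Var[Y; μ] 0 with hw | hw
  · simp [hw, covariance_eq_zero_of_variance_eq_zero hX hY hw]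
  · field_simp
    ring

end Regression

section RateDistortion

/-- The cost of a signal that leaves residual variance `r` about a Gaussian variable of variance `v`
and carries the least possible information `log (v / r) / 2`. -/
noncomputable def distortionCost (lam v r : ℝ) : ℝ :=
  r + lam / 2 * Real.log (v / r)

/-- The residual variance that minimizes `distortionCost lam v` over `(0, v]`. -/
noncomputable def optimalDistortion (lam v : ℝ) : ℝ :=
  min v (lam / 2)

variable {lam v r : ℝ}

theorem optimalDistortion_pos (hlam : 0 < lam) (hv : 0 < v) : 0 < optimalDistortion lam v :=
  lt_min hv (half_pos hlam)

theorem optimalDistortion_zero (hlam : 0 < lam) : optimalDistortion lam 0 = 0 :=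
  min_eq_left (half_pos hlam).le

theorem distortionCost_optimalDistortion_lt (hlam : 0 < lam) (hr : 0 < r) (hrv : r ≤ v)
    (hne : r ≠ optimalDistortion lam v) :
    distortionCost lam v (optimalDistortion lam v) < distortionCost lam v r := by
  have hv := hr.trans_le hrv
  have hD := optimalDistortion_pos hlam hv
  set D := optimalDistortion lam v
  have log_lt : Real.log (r / D) < r / D - 1 :=
    Real.log_lt_sub_one_of_pos (by positivity) (by rwa [Ne, div_eq_one_iff_eq hD.ne'])
  have log_eq : Real.log (r / D) = Real.log (v / D) - Real.log (v / r) := by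
    rw [Real.log_div hr.ne' hD.ne', Real.log_div hv.ne' hD.ne', Real.log_div hv.ne' hr.ne']
    ring
  have first_order : lam / 2 * (r / D - 1) ≤ r - D := by
    have gain_nonneg : 0 ≤ (r - D) * (D - lam / 2) := by
      rcases min_choice v (lam / 2) with h | h
      · have hDv : D = v := h
        have hv2 : v ≤ lam / 2 := min_eq_left_iff.1 h
        rw [hDv]
        exact mul_nonneg_of_nonpos_of_nonpos (by linarith) (by linarith)
      · have hD2 : D = lam / 2 := h
        simp [hD2]
    have gain_eq : r - D - lam / 2 * (r / D - 1) = (r - D) * (D - lam / 2) / D := by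
      field_simp
    rw [← sub_nonneg, gain_eq]
    positivity
  have scaled_log_lt := mul_lt_mul_of_pos_left log_lt (half_pos hlam)
  rw [log_eq] at scaled_log_lt
  rw [distortionCost, distortionCost]
  linarith

variable {Ω : Type*} [MeasurableSpace Ω] {μ : Measure Ω} [IsProbabilityMeasure μ] {X Y : Ω → ℝ}
  {m : ℝ} {v : ℝ≥0}

theorem log_add_le_mutualInfo {D : ℝ≥0} (hv : v ≠ 0) (hX : HasLaw X (gaussianReal m v) μ)
    (hY : MemLp Y 2 μ) (hI : mutualInfo μ X Y ≠ ∞) (hD : D ≠ 0) :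
    1 / 2 * Real.log (v / D) - residualVariance μ X Y / (2 * D) + 1 / 2
      ≤ (mutualInfo μ X Y).toReal := by
  have hX2 := memLp_two_of_hasLaw_gaussianReal hX
  obtain ⟨b, c, h⟩ := exists_regression hX2 hY
  rw [← h]
  exact le_toReal_mutualInfo_of_predictor hv hX hY.aestronglyMeasurable.aemeasurable hI
    (g := fun y => c + b * y) (by fun_prop) (memLp_sub_regression hX2 hY b c) hD

/- If the residual variance were `0`, then letting `D → 0` in the lower bound for the information
would make the information infinite. -/
theorem residualVariance_pos (hv : v ≠ 0) (hX : HasLaw X (gaussianReal m v) μ) (hY : MemLp Y 2 μ)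
    (hI : mutualInfo μ X Y ≠ ∞) : 0 < residualVariance μ X Y := by
  refine (residualVariance_nonneg (memLp_two_of_hasLaw_gaussianReal hX) hY).lt_of_ne' fun h => ?_
  set I := (mutualInfo μ X Y).toReal
  have hD : v * (Real.exp (-(2 * I))).toNNReal ≠ 0 := mul_ne_zero hv (by simp [Real.exp_pos])
  have hle := log_add_le_mutualInfo hv hX hY hI hD
  have hv' : (v : ℝ) ≠ 0 := by simpa using hv
  have log_eq : Real.log (v / (v * Real.exp (-(2 * I)))) = 2 * I := by
    rw [div_mul_cancel_left₀ hv', ← Real.exp_neg, neg_neg, Real.log_exp]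
  rw [h, zero_div, NNReal.coe_mul, Real.coe_toNNReal _ (Real.exp_pos _).le, log_eq] at hle
  linarith

theorem half_log_le_mutualInfo (hX : HasLaw X (gaussianReal m v) μ) (hY : MemLp Y 2 μ)
    (hI : mutualInfo μ X Y ≠ ∞) :
    1 / 2 * Real.log (v / residualVariance μ X Y) ≤ (mutualInfo μ X Y).toReal := by
  rcases eq_or_ne v 0 with rfl | hv
  · simp
  have hr := residualVariance_pos hv hX hY hI
  lift residualVariance μ X Y to ℝ≥0 using hr.le with r hrX
  have hle := log_add_le_mutualInfo hv hX hY hI (D := r) (by simpa using hr.ne')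
  rw [← hrX, div_mul_cancel_right₀ hr.ne'] at hle
  linarith

theorem distortionCost_residualVariance_add_le (hlam : 0 ≤ lam)
    (hX : HasLaw X (gaussianReal m v) μ) (hY : MemLp Y 2 μ) (hI : mutualInfo μ X Y ≠ ∞) :
    distortionCost lam v (residualVariance μ X Y) + (∫ ω, Y ω ∂μ - m) ^ 2
        + (Var[Y; μ] - cov[Y, X; μ]) ^ 2 / Var[Y; μ]
      ≤ ∫ ω, (Y ω - X ω) ^ 2 ∂μ + lam * (mutualInfo μ X Y).toReal := by
  have hlog := mul_le_mul_of_nonneg_left (half_log_le_mutualInfo hX hY hI) hlam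
  rw [integral_sub_sq_eq_residualVariance_add (memLp_two_of_hasLaw_gaussianReal hX) hY,
    hX.integral_eq, integral_id_gaussianReal, distortionCost]
  linarith

theorem residualVariance_eq_or_distortionCost_lt (hlam : 0 < lam)
    (hX : HasLaw X (gaussianReal m v) μ) (hY : MemLp Y 2 μ) (hI : mutualInfo μ X Y ≠ ∞) :
    residualVariance μ X Y = optimalDistortion lam v ∨
      distortionCost lam v (optimalDistortion lam v)
        < distortionCost lam v (residualVariance μ X Y) := by
  have hle : residualVariance μ X Y ≤ v := by
    simpa [hX.variance_eq] using residualVariance_le_variance (μ := μ) (X := X) (Y := Y)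
  rcases eq_or_ne v 0 with rfl | hv
  · left
    rw [NNReal.coe_zero, optimalDistortion_zero hlam]
    exact le_antisymm hle (residualVariance_nonneg (memLp_two_of_hasLaw_gaussianReal hX) hY)
  · exact or_iff_not_imp_left.2 <|
      distortionCost_optimalDistortion_lt hlam (residualVariance_pos hv hX hY hI) hle

theorem distortionCost_optimalDistortion_le_loss_add_info (hlam : 0 < lam)
    (hX : HasLaw X (gaussianReal m v) μ) (hY : MemLp Y 2 μ) (hI : mutualInfo μ X Y ≠ ∞) :
    distortionCost lam v (optimalDistortion lam v)
      ≤ ∫ ω, (Y ω - X ω) ^ 2 ∂μ + lam * (mutualInfo μ X Y).toReal := by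
  have hcost := distortionCost_residualVariance_add_le hlam.le hX hY hI
  have hmean := sq_nonneg (∫ ω, Y ω ∂μ - m)
  have hslope := div_nonneg (sq_nonneg (Var[Y; μ] - cov[Y, X; μ])) (variance_nonneg Y μ)
  rcases residualVariance_eq_or_distortionCost_lt hlam hX hY hI with h | h
  · rw [← h]
    linarith
  · linarith

theorem moments_of_loss_add_info_le (hlam : 0 < lam)
    (hX : HasLaw X (gaussianReal m v) μ) (hY : MemLp Y 2 μ) (hI : mutualInfo μ X Y ≠ ∞)
    (hle : ∫ ω, (Y ω - X ω) ^ 2 ∂μ + lam * (mutualInfo μ X Y).toReal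
      ≤ distortionCost lam v (optimalDistortion lam v)) :
    ∫ ω, Y ω ∂μ = m ∧ Var[Y; μ] = v - optimalDistortion lam v ∧ cov[Y, X; μ] = Var[Y; μ] := by
  have hX2 := memLp_two_of_hasLaw_gaussianReal hX
  have hcost := distortionCost_residualVariance_add_le hlam.le hX hY hI
  have hmean := sq_nonneg (∫ ω, Y ω ∂μ - m)
  have hslope := div_nonneg (sq_nonneg (Var[Y; μ] - cov[Y, X; μ])) (variance_nonneg Y μ)
  have hres : residualVariance μ X Y = optimalDistortion lam v :=
    (residualVariance_eq_or_distortionCost_lt hlam hX hY hI).resolve_right fun h => by linarith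
  rw [hres] at hcost
  have mean_eq : ∫ ω, Y ω ∂μ = m :=
    sub_eq_zero.1 <| pow_eq_zero_iff two_ne_zero |>.1 (by linarith)
  have cov_eq : cov[Y, X; μ] = Var[Y; μ] := by
    rcases div_eq_zero_iff.1 (hslope.antisymm' (by linarith)) with h | h
    · exact (sub_eq_zero.1 (pow_eq_zero_iff two_ne_zero |>.1 h)).symm
    · rw [h, covariance_eq_zero_of_variance_eq_zero hX2 hY h]
  refine ⟨mean_eq, ?_, cov_eq⟩
  rw [← hres, residualVariance, cov_eq, hX.variance_eq, variance_id_gaussianReal, pow_two,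
    mul_self_div_self, sub_sub_cancel]

end RateDistortion

section Objective

@[fun_prop]
theorem measurable_act : Measurable act := measurable_fst

@[fun_prop]
theorem measurable_agg : Measurable agg := measurable_fst.comp measurable_snd

@[fun_prop]
theorem measurable_state : Measurable state := measurable_snd.comp measurable_snd

@[fun_prop]
theorem measurable_target (α β : ℝ) : Measurable (target α β) := by
  unfold target
  fun_prop

variable {α β lam : ℝ} {μ : Measure Outcome}

theorem objective_eq_of_ne_top (hlam : 0 ≤ lam)
    (hloss : Integrable (fun ω => (act ω - target α β ω) ^ 2) μ)
    (hI : mutualInfo μ (target α β) act ≠ ∞) :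
    objective α β lam μ = ((-(∫ ω, (act ω - target α β ω) ^ 2 ∂μ
      + lam * (mutualInfo μ (target α β) act).toReal) : ℝ) : EReal) := by
  have loss_nonneg : 0 ≤ ∫ ω, (act ω - target α β ω) ^ 2 ∂μ := integral_nonneg fun _ => sq_nonneg _
  have cost_nonneg : 0 ≤ lam * (mutualInfo μ (target α β) act).toReal := by positivity
  have loss_eq : quadLoss α β μ = .ofReal (∫ ω, (act ω - target α β ω) ^ 2 ∂μ) :=
    (ofReal_integral_eq_lintegral_ofReal hloss (.of_forall fun _ => sq_nonneg _)).symm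
  have cost_eq : infoCost α β lam μ = .ofReal (lam * (mutualInfo μ (target α β) act).toReal) := by
    rw [infoCost, ENNReal.ofReal_mul hlam, ENNReal.ofReal_toReal hI]
  rw [objective, loss_eq, cost_eq, EReal.coe_ennreal_ofReal, EReal.coe_ennreal_ofReal,
    max_eq_left loss_nonneg, max_eq_left cost_nonneg, ← EReal.coe_neg, ← EReal.coe_sub, neg_add']

theorem integrable_of_objective_ne_bot (h : objective α β lam μ ≠ ⊥) :
    Integrable (fun ω => (act ω - target α β ω) ^ 2) μ := by
  have hmeas : Measurable fun ω => (act ω - target α β ω) ^ 2 := by fun_prop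
  refine ⟨hmeas.aestronglyMeasurable, ?_⟩
  rw [hasFiniteIntegral_iff_ofReal (.of_forall fun _ => sq_nonneg _), lt_top_iff_ne_top]
  contrapose! h
  have loss_eq : quadLoss α β μ = ∞ := h
  simp [objective, loss_eq, sub_eq_add_neg]

theorem mutualInfo_ne_top_of_objective_ne_bot (hlam : 0 < lam) (h : objective α β lam μ ≠ ⊥) :
    mutualInfo μ (target α β) act ≠ ∞ := by
  contrapose! h
  simp [objective, infoCost, h, ENNReal.mul_top, hlam, sub_eq_add_neg]

theorem memLp_act_of_objective_ne_bot (hT : MemLp (target α β) 2 μ)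
    (h : objective α β lam μ ≠ ⊥) : MemLp act 2 μ := by
  have hmeas : Measurable fun ω => act ω - target α β ω := by fun_prop
  have hdiff : MemLp (fun ω => act ω - target α β ω) 2 μ :=
    (memLp_two_iff_integrable_sq hmeas.aestronglyMeasurable).2 (integrable_of_objective_ne_bot h)
  exact (hdiff.add hT).ae_eq (.of_forall fun _ => sub_add_cancel _ _)

variable [IsProbabilityMeasure μ] {m : ℝ} {v : ℝ≥0}

theorem objective_le (hlam : 0 < lam) (hT : HasLaw (target α β) (gaussianReal m v) μ) :
    objective α β lam μ ≤ ((-distortionCost lam v (optimalDistortion lam v) : ℝ) : EReal) := by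
  by_cases h : objective α β lam μ = ⊥
  · exact h ▸ bot_le
  have hI := mutualInfo_ne_top_of_objective_ne_bot hlam h
  have hact := memLp_act_of_objective_ne_bot (memLp_two_of_hasLaw_gaussianReal hT) h
  rw [objective_eq_of_ne_top hlam.le (integrable_of_objective_ne_bot h) hI, EReal.coe_le_coe_iff]
  exact neg_le_neg (distortionCost_optimalDistortion_le_loss_add_info hlam hT hact hI)

theorem moments_of_le_objective (hlam : 0 < lam) (hT : HasLaw (target α β) (gaussianReal m v) μ)
    (hle : ((-distortionCost lam v (optimalDistortion lam v) : ℝ) : EReal)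
      ≤ objective α β lam μ) :
    ∫ ω, act ω ∂μ = m ∧ Var[act; μ] = v - optimalDistortion lam v ∧
      cov[act, target α β; μ] = Var[act; μ] := by
  have h : objective α β lam μ ≠ ⊥ := ne_bot_of_le_ne_bot (EReal.coe_ne_bot _) hle
  have hI := mutualInfo_ne_top_of_objective_ne_bot hlam h
  have hact := memLp_act_of_objective_ne_bot (memLp_two_of_hasLaw_gaussianReal hT) h
  rw [objective_eq_of_ne_top hlam.le (integrable_of_objective_ne_bot h) hI,
    EReal.coe_le_coe_iff] at hle
  exact moments_of_loss_add_info_le hlam hT hact hI (neg_le_neg_iff.1 hle)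

end Objective

section NoisySignal

/-- The law of `(a_i, A, θ)` if `(A, θ)` has law `ν` and `a_i = c + g (α A + β θ) + e`, where the
noise `e` is independent of `(A, θ)` and has law `N(0, s)`. -/
noncomputable def noisySignal (α β c g : ℝ) (s : ℝ≥0) (ν : Measure (ℝ × ℝ)) : Measure Outcome :=
  (ν.prod (gaussianReal 0 s)).map fun z => (c + g * targetFn α β z.1 + z.2, z.1)

attribute [fun_prop] measurable_targetFn

theorem measurable_noisySignal_map {α β c g : ℝ} :
    Measurable fun z : (ℝ × ℝ) × ℝ => (c + g * targetFn α β z.1 + z.2, z.1) := by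
  fun_prop

variable {α β c g : ℝ} {s : ℝ≥0} {ν : Measure (ℝ × ℝ)}

theorem isGaussian_noisySignal [IsGaussian ν] : IsGaussian (noisySignal α β c g s ν) := by
  let fst := ContinuousLinearMap.fst ℝ (ℝ × ℝ) ℝ
  let L : ((ℝ × ℝ) × ℝ) →L[ℝ] Outcome :=
    ((g * α) • (ContinuousLinearMap.fst ℝ ℝ ℝ).comp fst
      + (g * β) • (ContinuousLinearMap.snd ℝ ℝ ℝ).comp fst
      + ContinuousLinearMap.snd ℝ (ℝ × ℝ) ℝ).prod fst
  have noisySignal_eq : noisySignal α β c g s ν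
      = ((ν.prod (gaussianReal 0 s)).map L).map (fun x => x + ((c, 0) : Outcome)) := by
    rw [noisySignal, Measure.map_map (by fun_prop) (by fun_prop)]
    congr 1
    ext z
    · simp [L, fst, targetFn]
      ring
    · simp [L, fst]
    · simp [L, fst]
  rw [noisySignal_eq]
  infer_instance

theorem noisySignal_map_target_act [SFinite ν] :
    (noisySignal α β c g s ν).map (fun ω => (target α β ω, act ω))
      = ((ν.map (targetFn α β)).prod (gaussianReal 0 s)).map
          (fun z => (z.1, c + g * z.1 + z.2)) := by
  have prod_eq : (ν.map (targetFn α β)).prod (gaussianReal 0 s)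
      = (ν.prod (gaussianReal 0 s)).map (Prod.map (targetFn α β) id) := by
    rw [← Measure.map_prod_map _ _ (measurable_targetFn α β) measurable_id, Measure.map_id]
  rw [prod_eq, noisySignal, Measure.map_map (by fun_prop) measurable_noisySignal_map,
    Measure.map_map (by fun_prop) (by fun_prop)]
  rfl

theorem hasLaw_snd_noisySignal : HasLaw Prod.snd ν (noisySignal α β c g s ν) where
  aemeasurable := measurable_snd.aemeasurable
  map_eq := by
    rw [noisySignal, Measure.map_map measurable_snd measurable_noisySignal_map]
    exact measurePreserving_fst.map_eq

/-- The Gaussian channel that sends an input `x` to the law `N(c + g x, s)`. -/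
noncomputable def gaussianChannel (c g : ℝ) (s : ℝ≥0) : Kernel ℝ ℝ where
  toFun x := gaussianReal (c + g * x) s
  measurable' := measurable_gaussianReal.comp (f := fun x : ℝ => (c + g * x, s)) (by fun_prop)

instance isMarkovKernel_gaussianChannel : IsMarkovKernel (gaussianChannel c g s) :=
  ⟨fun x => instIsProbabilityMeasureGaussianReal (c + g * x) s⟩

theorem gaussianChannel_apply (x : ℝ) :
    gaussianChannel c g s x = (gaussianReal 0 s).map (fun e => c + g * x + e) := by
  rw [gaussianReal_map_const_add, zero_add]
  rfl

theorem isTargetSignal_noisySignal [SFinite ν] :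
    IsTargetSignal α β (noisySignal α β c g s ν) := by
  refine ⟨gaussianChannel c g s, inferInstance, ?_⟩
  rw [hasLaw_snd_noisySignal.map_eq]
  ext S hS
  have hS' : MeasurableSet (Prod.swap ⁻¹' S : Set ((ℝ × ℝ) × ℝ)) := measurable_swap hS
  rw [noisySignal, Measure.map_apply measurable_noisySignal_map hS,
    Measure.prod_apply (measurable_noisySignal_map hS), Measure.map_apply measurable_swap hS,
    Measure.compProd_apply hS']
  refine lintegral_congr fun p => ?_
  rw [Kernel.comap_apply, gaussianChannel_apply,
    Measure.map_apply (by fun_prop) (measurable_prodMk_left hS')]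
  rfl

theorem hasLaw_affine_add_noise {Ω : Type*} [MeasurableSpace Ω] {ρ : Measure Ω}
    [IsProbabilityMeasure ρ] {X : Ω → ℝ} {m : ℝ} {v w : ℝ≥0} (hX : HasLaw X (gaussianReal m v) ρ)
    (hw : (w : ℝ) = g ^ 2 * v + s) :
    HasLaw (fun z : Ω × ℝ => c + g * X z.1 + z.2) (gaussianReal (c + g * m) w)
      (ρ.prod (gaussianReal 0 s)) := by
  have signal : HasLaw (fun x => c + g * X x) (gaussianReal (c + g * m) (.mk (g ^ 2) _ * v)) ρ :=
    add_comm c (g * m) ▸ gaussianReal_const_add (gaussianReal_const_mul hX g) c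
  have noise : HasLaw id (gaussianReal 0 s) (gaussianReal 0 s) := .id
  have indep := indepFun_prod₀ signal.aemeasurable noise.aemeasurable
  have signal_fst := signal.comp (measurePreserving_fst (ν := gaussianReal 0 s)).hasLaw
  have noise_snd := noise.comp (measurePreserving_snd (μ := ρ)).hasLaw
  refine ⟨signal_fst.aemeasurable.add noise_snd.aemeasurable, ?_⟩
  have h := gaussianReal_add_gaussianReal_of_indepFun indep signal_fst.map_eq noise_snd.map_eq
  rwa [add_zero, ← show w = .mk (g ^ 2) (sq_nonneg g) * v + s from NNReal.eq hw] at h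

variable {m : ℝ} {v w : ℝ≥0}

theorem hasLaw_noisySignal {P : Measure ℝ} {F : Outcome → ℝ} (hF : Measurable F)
    (h : HasLaw (fun z => F (c + g * targetFn α β z.1 + z.2, z.1)) P (ν.prod (gaussianReal 0 s))) :
    HasLaw F P (noisySignal α β c g s ν) :=
  .comp_of_hasLaw_comp hF.aemeasurable ⟨measurable_noisySignal_map.aemeasurable, rfl⟩ .id h

theorem hasLaw_target_noisySignal (hT : HasLaw (targetFn α β) (gaussianReal m v) ν) :
    HasLaw (target α β) (gaussianReal m v) (noisySignal α β c g s ν) :=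
  hT.comp hasLaw_snd_noisySignal

variable [IsProbabilityMeasure ν]

instance isProbabilityMeasure_noisySignal : IsProbabilityMeasure (noisySignal α β c g s ν) :=
  Measure.isProbabilityMeasure_map measurable_noisySignal_map.aemeasurable

theorem hasLaw_act_noisySignal (hT : HasLaw (targetFn α β) (gaussianReal m v) ν)
    (hw : (w : ℝ) = g ^ 2 * v + s) :
    HasLaw act (gaussianReal (c + g * m) w) (noisySignal α β c g s ν) :=
  hasLaw_noisySignal measurable_act (hasLaw_affine_add_noise hT hw)

theorem hasLaw_act_sub_target_noisySignal (hT : HasLaw (targetFn α β) (gaussianReal m v) ν)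
    (hw : (w : ℝ) = (g - 1) ^ 2 * v + s) :
    HasLaw (fun ω => act ω - target α β ω) (gaussianReal (c + (g - 1) * m) w)
      (noisySignal α β c g s ν) := by
  refine hasLaw_noisySignal (by fun_prop) ?_
  convert hasLaw_affine_add_noise (c := c) hT hw using 2 with z
  simp only [act, target, agg, state, targetFn]
  ring

theorem mutualInfo_noisySignal (hT : HasLaw (targetFn α β) (gaussianReal m v) ν) (hs : s ≠ 0)
    (hw0 : w ≠ 0) (hw : (w : ℝ) = g ^ 2 * v + s) :
    mutualInfo (noisySignal α β c g s ν) (target α β) act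
      = .ofReal (1 / 2 * Real.log (w / s)) := by
  rw [mutualInfo, noisySignal_map_target_act, (hasLaw_target_noisySignal hT).map_eq,
    (hasLaw_act_noisySignal hT hw).map_eq, hT.map_eq]
  exact klDiv_prod_map_add_noise (a := fun x => c + g * x) (by fun_prop) hw0 hs
    (hasLaw_affine_add_noise .id hw)

theorem mutualInfo_eq_zero_of_hasLaw_dirac {Ω : Type*} [MeasurableSpace Ω] {μ : Measure Ω}
    [IsProbabilityMeasure μ] {X Y : Ω → ℝ} (hX : AEMeasurable X μ) (hY : HasLaw Y (.dirac m) μ) :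
    mutualInfo μ X Y = 0 := by
  have indep : IndepFun X Y μ :=
    (indepFun_const_right X m).congr .rfl hY.ae_eq_of_dirac.symm
  have := Measure.isProbabilityMeasure_map hX
  have := Measure.isProbabilityMeasure_map hY.aemeasurable
  rw [mutualInfo, (indepFun_iff_map_prod_eq_prod_map_map hX hY.aemeasurable).1 indep, klDiv_self]

end NoisySignal

section OptimalSignal

/-- The regression coefficient on the target of the optimal signal about a target of variance
`v`. -/
noncomputable def optimalSlope (lam v : ℝ) : ℝ := (v - optimalDistortion lam v) / v

section Slope

variable {lam v : ℝ}

theorem optimalSlope_mul_self (hlam : 0 < lam) :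
    optimalSlope lam v * v = v - optimalDistortion lam v := by
  refine div_mul_cancel_of_imp fun hv => ?_
  rw [hv, optimalDistortion_zero hlam, sub_zero]

theorem optimalSlope_nonneg (hv : 0 ≤ v) : 0 ≤ optimalSlope lam v :=
  div_nonneg (sub_nonneg.2 (min_le_left _ _)) hv

theorem optimalSlope_lt_one (hlam : 0 < lam) (hv : 0 ≤ v) : optimalSlope lam v < 1 := by
  rcases hv.eq_or_lt with rfl | hv
  · simp [optimalSlope]
  · exact (div_lt_one hv).2 (sub_lt_self v (optimalDistortion_pos hlam hv))

theorem optimalSlope_eq_zero_iff (hv : 0 < v) : optimalSlope lam v = 0 ↔ v ≤ lam / 2 := by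
  rw [optimalSlope, div_eq_zero_iff, or_iff_left hv.ne', sub_eq_zero, eq_comm, optimalDistortion,
    min_eq_left_iff]

theorem optimalSlope_eq_iff_of_pos {γ : ℝ} (hv : 0 < v) (hγ : 0 < γ) :
    optimalSlope lam v = γ ↔ v * (1 - γ) = lam / 2 := by
  rw [optimalSlope, div_eq_iff hv.ne', optimalDistortion]
  constructor
  · intro h
    rcases min_choice v (lam / 2) with hmin | hmin
    · exact absurd (h.symm.trans (sub_eq_zero.2 hmin.symm)) (mul_pos hγ hv).ne'
    · linear_combination h + hmin
  · intro h
    rw [min_eq_right (by nlinarith), ← h]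
    ring

theorem optimalDistortion_nonneg (hlam : 0 ≤ lam) (hv : 0 ≤ v) : 0 ≤ optimalDistortion lam v :=
  le_min hv (by positivity)

theorem coe_optimalSlope_mul_optimalDistortion (hlam : 0 ≤ lam) (hv : 0 ≤ v) :
    ((optimalSlope lam v * optimalDistortion lam v).toNNReal : ℝ)
      = optimalSlope lam v * optimalDistortion lam v :=
  Real.coe_toNNReal _ (mul_nonneg (optimalSlope_nonneg hv) (optimalDistortion_nonneg hlam hv))

end Slope

variable {α β lam m : ℝ} {v : ℝ≥0} {ν : Measure (ℝ × ℝ)}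

/-- The optimal signal about a target with law `N(m, v)`: the target given this signal has residual
variance `optimalDistortion lam v`. -/
noncomputable def optimalSignal (α β lam m : ℝ) (v : ℝ≥0) (ν : Measure (ℝ × ℝ)) :
    Measure Outcome :=
  noisySignal α β ((1 - optimalSlope lam v) * m) (optimalSlope lam v)
    (optimalSlope lam v * optimalDistortion lam v).toNNReal ν

theorem coe_sub_optimalDistortion_eq {w : ℝ≥0} (hlam : 0 < lam)
    (hw : (w : ℝ) = v - optimalDistortion lam v) :
    (w : ℝ) = optimalSlope lam v ^ 2 * v
      + (optimalSlope lam v * optimalDistortion lam v).toNNReal := by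
  rw [coe_optimalSlope_mul_optimalDistortion hlam.le v.coe_nonneg, hw]
  linear_combination (-1 - optimalSlope lam v) * optimalSlope_mul_self (v := (v : ℝ)) hlam

variable [IsProbabilityMeasure ν]

instance isProbabilityMeasure_optimalSignal :
    IsProbabilityMeasure (optimalSignal α β lam m v ν) :=
  isProbabilityMeasure_noisySignal

theorem hasLaw_act_optimalSignal {w : ℝ≥0} (hlam : 0 < lam)
    (hT : HasLaw (targetFn α β) (gaussianReal m v) ν) (hw : (w : ℝ) = v - optimalDistortion lam v) :
    HasLaw act (gaussianReal m w) (optimalSignal α β lam m v ν) := by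
  have law := hasLaw_act_noisySignal (c := (1 - optimalSlope lam v) * m) hT
    (coe_sub_optimalDistortion_eq hlam hw)
  rwa [show (1 - optimalSlope lam v) * m + optimalSlope lam v * m = m by ring] at law

theorem hasLaw_act_sub_target_optimalSignal {D : ℝ≥0} (hlam : 0 < lam)
    (hT : HasLaw (targetFn α β) (gaussianReal m v) ν) (hD : (D : ℝ) = optimalDistortion lam v) :
    HasLaw (fun ω => act ω - target α β ω) (gaussianReal 0 D) (optimalSignal α β lam m v ν) := by
  have variance_eq : (D : ℝ) = (optimalSlope lam v - 1) ^ 2 * v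
      + (optimalSlope lam v * optimalDistortion lam v).toNNReal := by
    rw [coe_optimalSlope_mul_optimalDistortion hlam.le v.coe_nonneg, hD]
    linear_combination (1 - optimalSlope lam v) * optimalSlope_mul_self (v := (v : ℝ)) hlam
  have law := hasLaw_act_sub_target_noisySignal (c := (1 - optimalSlope lam v) * m) hT variance_eq
  rwa [show (1 - optimalSlope lam v) * m + (optimalSlope lam v - 1) * m = 0 by ring] at law

theorem mutualInfo_optimalSignal (hlam : 0 < lam)
    (hT : HasLaw (targetFn α β) (gaussianReal m v) ν) :
    mutualInfo (optimalSignal α β lam m v ν) (target α β) act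
      = .ofReal (1 / 2 * Real.log (v / optimalDistortion lam v)) := by
  rcases le_or_gt (v : ℝ) (lam / 2) with hv | hv
  · have hD : optimalDistortion lam v = v := min_eq_left hv
    have hact := hasLaw_act_optimalSignal (w := 0) hlam hT (by simp [hD])
    rw [gaussianReal_zero_var] at hact
    rw [mutualInfo_eq_zero_of_hasLaw_dirac (measurable_target α β).aemeasurable hact, hD]
    simp
  · have hD : 0 < optimalDistortion lam v := optimalDistortion_pos hlam ((half_pos hlam).trans hv)
    have hDv : 0 < v - optimalDistortion lam v := sub_pos.2 (min_lt_of_right_lt hv)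
    have hg : 0 < optimalSlope lam v :=
      pos_of_mul_pos_left (hDv.trans_eq (optimalSlope_mul_self hlam).symm) v.2
    lift v - optimalDistortion lam v to ℝ≥0 using hDv.le with w hw
    rw [optimalSignal, mutualInfo_noisySignal hT (Real.toNNReal_pos.2 (mul_pos hg hD)).ne'
      (by exact_mod_cast hDv.ne') (coe_sub_optimalDistortion_eq hlam hw),
      coe_optimalSlope_mul_optimalDistortion hlam.le v.coe_nonneg, hw, ← optimalSlope_mul_self hlam,
      mul_div_mul_left _ _ hg.ne']

theorem objective_optimalSignal (hlam : 0 < lam)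
    (hT : HasLaw (targetFn α β) (gaussianReal m v) ν) :
    objective α β lam (optimalSignal α β lam m v ν)
      = ((-distortionCost lam v (optimalDistortion lam v) : ℝ) : EReal) := by
  have hI := mutualInfo_optimalSignal hlam hT
  have hD := optimalDistortion_nonneg hlam.le v.coe_nonneg
  have log_nonneg : 0 ≤ 1 / 2 * Real.log (v / optimalDistortion lam v) := by
    rcases eq_or_ne v 0 with rfl | hv
    · simp
    have hlog := Real.log_nonneg <| (one_le_div (optimalDistortion_pos hlam
      (NNReal.coe_pos.2 hv.pos))).2 (min_le_left (v : ℝ) (lam / 2))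
    positivity
  have loss := hasLaw_act_sub_target_optimalSignal (D := (optimalDistortion lam v).toNNReal) hlam hT
    (Real.coe_toNNReal _ hD)
  have loss_memLp := memLp_two_of_hasLaw_gaussianReal loss
  have loss_eq := integral_sq_eq_variance_add_sq loss_memLp
  rw [loss.integral_eq, loss.variance_eq, integral_id_gaussianReal, variance_id_gaussianReal,
    Real.coe_toNNReal _ hD] at loss_eq
  rw [objective_eq_of_ne_top hlam.le loss_memLp.integrable_sq (hI ▸ ENNReal.ofReal_ne_top), hI,
    ENNReal.toReal_ofReal log_nonneg, loss_eq, distortionCost]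
  congr 2
  ring

end OptimalSignal

section TargetSignal

variable {α β : ℝ} {μ : Measure Outcome}

theorem IsTargetSignal.exists_integral_act_mul_eq [IsFiniteMeasure μ] (h : IsTargetSignal α β μ) :
    ∃ r : ℝ → ℝ, Measurable r ∧ ∀ B : ℝ × ℝ → ℝ, Measurable B →
      Integrable (fun ω => act ω * B ω.2) μ →
      ∫ ω, act ω * B ω.2 ∂μ = ∫ ω, r (target α β ω) * B ω.2 ∂μ := by
  obtain ⟨κ, _, hμ⟩ := h
  have mean_measurable : StronglyMeasurable fun x => ∫ y, y ∂κ x :=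
    StronglyMeasurable.integral_kernel (κ := κ) (f := fun y => y) stronglyMeasurable_id
  refine ⟨fun x => ∫ y, y ∂κ x, mean_measurable.measurable, fun B hB hint => ?_⟩
  set κT := κ.comap (targetFn α β) (measurable_targetFn α β)
  have hmeas : Measurable fun ω : Outcome => act ω * B ω.2 := by fun_prop
  have hint_comp : Integrable (fun z : (ℝ × ℝ) × ℝ => z.2 * B z.1) (μ.map Prod.snd ⊗ₘ κT) := by
    rw [hμ, integrable_map_measure hmeas.aestronglyMeasurable measurable_swap.aemeasurable] at hint
    exact hint
  calc ∫ ω, act ω * B ω.2 ∂μ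
      = ∫ ω, act ω * B ω.2 ∂(μ.map Prod.snd ⊗ₘ κT).map Prod.swap := by rw [← hμ]
    _ = ∫ z, z.2 * B z.1 ∂(μ.map Prod.snd ⊗ₘ κT) :=
      integral_map measurable_swap.aemeasurable hmeas.aestronglyMeasurable
    _ = ∫ p, (∫ y, y ∂κT p) * B p ∂μ.map Prod.snd := by
      rw [Measure.integral_compProd hint_comp]
      simp only [integral_mul_const]
    _ = _ := integral_map measurable_snd.aemeasurable
      ((mean_measurable.comp_measurable (measurable_targetFn α β)).mul
        hB.stronglyMeasurable).aestronglyMeasurable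

variable [IsProbabilityMeasure μ] {Y : ℝ × ℝ → ℝ}

theorem IsTargetSignal.covariance_act_eq_zero (h : IsTargetSignal α β μ) (hact : MemLp act 2 μ)
    (hY : Measurable Y) (hY2 : MemLp (fun ω : Outcome => Y ω.2) 2 μ)
    (indep : IndepFun (target α β) (fun ω : Outcome => Y ω.2) μ) :
    cov[act, fun ω => Y ω.2; μ] = 0 := by
  obtain ⟨r, hr, integral_act_mul⟩ := h.exists_integral_act_mul_eq
  have integral_act : ∫ ω, act ω ∂μ = ∫ ω, r (target α β ω) ∂μ := by
    simpa using integral_act_mul (fun _ => 1) measurable_const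
      (by simpa using hact.integrable (by norm_num))
  rw [covariance_eq_sub hact hY2, sub_eq_zero, integral_act]
  exact (integral_act_mul Y hY (hact.integrable_mul hY2)).trans <|
    (indep.comp hr measurable_id).integral_mul_eq_mul_integral
      (hr.comp (measurable_target α β)).aestronglyMeasurable hY2.aestronglyMeasurable

/-- The part of `Y` that is uncorrelated with the target is independent of it by joint normality,
hence uncorrelated with the action. -/
theorem IsTargetSignal.variance_target_mul_covariance (h : IsTargetSignal α β μ)
    (hact : MemLp act 2 μ) (hY : Measurable Y)
    (hlaw : HasGaussianLaw (fun ω : Outcome => (target α β ω, Y ω.2)) μ) :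
    Var[target α β; μ] * cov[act, fun ω => Y ω.2; μ]
      = cov[act, target α β; μ] * cov[target α β, fun ω => Y ω.2; μ] := by
  have hT2 : MemLp (target α β) 2 μ := hlaw.fst.memLp_two
  have hY2 : MemLp (fun ω : Outcome => Y ω.2) 2 μ := hlaw.snd.memLp_two
  rcases eq_or_ne (Var[target α β; μ]) 0 with hV | hV
  · rw [hV, zero_mul, covariance_comm act (target α β),
      covariance_eq_zero_of_variance_eq_zero hact hT2 hV, zero_mul]
  set δ := cov[target α β, fun ω => Y ω.2; μ] / Var[target α β; μ] with hδ
  set R : ℝ × ℝ → ℝ := fun p => Y p - δ * targetFn α β p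
  have hδT2 : MemLp (fun ω => δ * target α β ω) 2 μ := hT2.const_mul δ
  have hR2 : MemLp (fun ω : Outcome => R ω.2) 2 μ := hY2.sub hδT2
  have covariance_R : ∀ {X : Outcome → ℝ}, MemLp X 2 μ → cov[X, fun ω => R ω.2; μ]
      = cov[X, fun ω => Y ω.2; μ] - δ * cov[X, target α β; μ] := fun hX => by
    rw [← covariance_const_mul_right, ← covariance_fun_sub_right hX hY2 hδT2]
    rfl
  have uncorrelated : cov[target α β, fun ω => R ω.2; μ] = 0 := by
    rw [covariance_R hT2, covariance_self (measurable_target α β).aemeasurable, hδ,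
      div_mul_cancel₀ _ hV, sub_self]
  have hlaw_R : HasGaussianLaw (fun ω => (target α β ω, R ω.2)) μ :=
    hlaw.map ((ContinuousLinearMap.fst ℝ ℝ ℝ).prod
      (ContinuousLinearMap.snd ℝ ℝ ℝ - δ • ContinuousLinearMap.fst ℝ ℝ ℝ))
  have covariance_act_R := h.covariance_act_eq_zero hact (by fun_prop) hR2
    (hlaw_R.indepFun_of_covariance_eq_zero uncorrelated)
  rw [covariance_R hact, hδ, sub_eq_zero] at covariance_act_R
  rw [covariance_act_R]
  field_simp

end TargetSignal

section GaussianOutcome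

variable {α β : ℝ} {μ ν : Measure Outcome} [IsGaussian μ] [IsGaussian ν]

/-- The aggregate action as a continuous linear functional. -/
noncomputable def aggCLM : Outcome →L[ℝ] ℝ := .comp (.fst ℝ ℝ ℝ) (.snd ℝ ℝ (ℝ × ℝ))

/-- The state as a continuous linear functional. -/
noncomputable def stateCLM : Outcome →L[ℝ] ℝ := .comp (.snd ℝ ℝ ℝ) (.snd ℝ ℝ (ℝ × ℝ))

theorem hasGaussianLaw_clm {E : Type*} [NormedAddCommGroup E] [NormedSpace ℝ E]
    [MeasurableSpace E] [BorelSpace E] (L : Outcome →L[ℝ] E) : HasGaussianLaw L μ :=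
  IsGaussian.hasGaussianLaw_id.map L

theorem memLp_act : MemLp act 2 μ := (hasGaussianLaw_clm (.fst ℝ ℝ (ℝ × ℝ))).memLp_two

theorem memLp_agg : MemLp agg 2 μ := (hasGaussianLaw_clm aggCLM).memLp_two

theorem memLp_state : MemLp state 2 μ := (hasGaussianLaw_clm stateCLM).memLp_two

theorem memLp_target : MemLp (target α β) 2 μ :=
  (hasGaussianLaw_clm (α • aggCLM + β • stateCLM)).memLp_two

theorem hasLaw_target :
    HasLaw (target α β) (gaussianReal (∫ ω, target α β ω ∂μ) Var[target α β; μ].toNNReal) μ :=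
  ⟨(measurable_target α β).aemeasurable,
    (hasGaussianLaw_clm (α • aggCLM + β • stateCLM)).map_eq_gaussianReal⟩

theorem integral_target :
    ∫ ω, target α β ω ∂μ = α * ∫ ω, agg ω ∂μ + β * ∫ ω, state ω ∂μ := by
  rw [← integral_const_mul, ← integral_const_mul]
  exact integral_add ((memLp_agg.integrable one_le_two).const_mul α)
    ((memLp_state.integrable one_le_two).const_mul β)

theorem covariance_target_left {Y : Outcome → ℝ} (hY : MemLp Y 2 μ) :
    cov[target α β, Y; μ] = α * cov[agg, Y; μ] + β * cov[state, Y; μ] := by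
  rw [← covariance_const_mul_left, ← covariance_const_mul_left]
  exact covariance_add_left (memLp_agg.const_mul α) (memLp_state.const_mul β) hY

theorem variance_target :
    Var[target α β; μ]
      = α ^ 2 * Var[agg; μ] + 2 * α * β * cov[agg, state; μ] + β ^ 2 * Var[state; μ] := by
  rw [← covariance_self (measurable_target α β).aemeasurable, covariance_target_left memLp_target,
    covariance_comm agg, covariance_comm state, covariance_target_left memLp_agg,
    covariance_target_left memLp_state, covariance_comm state agg,
    covariance_self measurable_agg.aemeasurable, covariance_self measurable_state.aemeasurable]
  ring

theorem exists_clm_eq (L : StrongDual ℝ Outcome) :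
    ∃ x a b : ℝ, (L : Outcome → ℝ) = fun ω => x * act ω + target a b ω := by
  refine ⟨L (1, 0, 0), L (0, 1, 0), L (0, 0, 1), funext fun ω => ?_⟩
  have expand : ω = act ω • ((1, 0, 0) : Outcome) + (agg ω • ((0, 1, 0) : Outcome)
      + state ω • ((0, 0, 1) : Outcome)) := by
    ext <;> simp [act, agg, state]
  conv_lhs => rw [expand]
  simp only [map_add, map_smul, smul_eq_mul, target, mul_comm]

theorem integral_mul_act_add_target {x : ℝ} :
    ∫ ω, (x * act ω + target α β ω) ∂μ
      = x * ∫ ω, act ω ∂μ + (α * ∫ ω, agg ω ∂μ + β * ∫ ω, state ω ∂μ) := by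
  rw [integral_add ((memLp_act.integrable one_le_two).const_mul x)
    (memLp_target.integrable one_le_two), integral_const_mul, integral_target]

theorem variance_mul_act_add_target {x : ℝ} :
    Var[fun ω => x * act ω + target α β ω; μ] = x ^ 2 * Var[act; μ]
      + 2 * x * (α * cov[act, agg; μ] + β * cov[act, state; μ]) + Var[target α β; μ] := by
  rw [variance_fun_add (memLp_act.const_mul x) memLp_target, variance_const_mul,
    covariance_const_mul_left, covariance_comm act, covariance_target_left memLp_act,
    covariance_comm agg, covariance_comm state]
  ring

theorem ext_of_moments
    (mean_act : ∫ ω, act ω ∂μ = ∫ ω, act ω ∂ν) (mean_agg : ∫ ω, agg ω ∂μ = ∫ ω, agg ω ∂ν)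
    (mean_state : ∫ ω, state ω ∂μ = ∫ ω, state ω ∂ν) (var_act : Var[act; μ] = Var[act; ν])
    (var_agg : Var[agg; μ] = Var[agg; ν]) (var_state : Var[state; μ] = Var[state; ν])
    (cov_act_agg : cov[act, agg; μ] = cov[act, agg; ν])
    (cov_act_state : cov[act, state; μ] = cov[act, state; ν])
    (cov_agg_state : cov[agg, state; μ] = cov[agg, state; ν]) : μ = ν := by
  refine Measure.ext_of_charFunDual (funext fun L => ?_)
  obtain ⟨x, a, b, hL⟩ := exists_clm_eq L
  simp only [IsGaussian.charFunDual_eq, integral_complex_ofReal, hL, integral_mul_act_add_target,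
    variance_mul_act_add_target, variance_target, mean_act, mean_agg, mean_state, var_act, var_agg,
    var_state, cov_act_agg, cov_act_state, cov_agg_state]

end GaussianOutcome

section OptimalMoments

variable {α β lam : ℝ}

theorem isOptimalSignal_optimalSignal {m : ℝ} {v : ℝ≥0} {ν : Measure (ℝ × ℝ)}
    [IsProbabilityMeasure ν] (hlam : 0 < lam) (hT : HasLaw (targetFn α β) (gaussianReal m v) ν) :
    IsOptimalSignal α β lam (optimalSignal α β lam m v ν) := by
  refine ⟨isTargetSignal_noisySignal, fun μ' _ _ hsnd => ?_⟩
  rw [optimalSignal, hasLaw_snd_noisySignal.map_eq] at hsnd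
  exact (objective_le hlam (hT.comp ⟨measurable_snd.aemeasurable, hsnd⟩)).trans_eq
    (objective_optimalSignal hlam hT).symm

variable {μ : Measure Outcome} [IsGaussian μ]

theorem IsOptimalSignal.moments (h : IsOptimalSignal α β lam μ) (hlam : 0 < lam) :
    ∫ ω, act ω ∂μ = ∫ ω, target α β ω ∂μ ∧
      Var[act; μ] = Var[target α β; μ] - optimalDistortion lam Var[target α β; μ] ∧
      cov[act, target α β; μ] = Var[act; μ] := by
  have hT := hasLaw_target (α := α) (β := β) (μ := μ)
  have hT_snd : HasLaw (targetFn α β)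
      (gaussianReal (∫ ω, target α β ω ∂μ) Var[target α β; μ].toNNReal) (μ.map Prod.snd) :=
    ⟨(measurable_targetFn α β).aemeasurable,
      (Measure.map_map (measurable_targetFn α β) measurable_snd).trans hT.map_eq⟩
  have : IsProbabilityMeasure (μ.map Prod.snd) :=
    Measure.isProbabilityMeasure_map measurable_snd.aemeasurable
  have le_objective := (objective_optimalSignal hlam hT_snd).symm.trans_le <|
    h.2 _ isProbabilityMeasure_optimalSignal isTargetSignal_noisySignal
      hasLaw_snd_noisySignal.map_eq
  have moments := moments_of_le_objective hlam hT le_objective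
  rwa [Real.coe_toNNReal _ (variance_nonneg (target α β) μ)] at moments

theorem IsOptimalSignal.infoFraction_eq (h : IsOptimalSignal α β lam μ) (hlam : 0 < lam) :
    infoFraction α β μ = optimalSlope lam Var[target α β; μ] := by
  rw [infoFraction, (h.moments hlam).2.1, optimalSlope]

theorem IsOptimalSignal.var_act (h : IsOptimalSignal α β lam μ) (hlam : 0 < lam) :
    Var[act; μ] = infoFraction α β μ * Var[target α β; μ] := by
  refine (div_mul_cancel_of_imp fun hV => ?_).symm
  rw [(h.moments hlam).2.1, hV, optimalDistortion_zero hlam, sub_zero]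

theorem IsOptimalSignal.cov_act (h : IsOptimalSignal α β lam μ) (hlam : 0 < lam)
    (Y : StrongDual ℝ (ℝ × ℝ)) :
    cov[act, fun ω => Y ω.2; μ] = infoFraction α β μ * cov[target α β, fun ω => Y ω.2; μ] := by
  have hlaw : HasGaussianLaw (fun ω : Outcome => (target α β ω, Y ω.2)) μ :=
    hasGaussianLaw_clm ((α • aggCLM + β • stateCLM).prod (Y.comp (.snd ℝ ℝ (ℝ × ℝ))))
  have hY2 : MemLp (fun ω : Outcome => Y ω.2) 2 μ := hlaw.snd.memLp_two
  have channel := h.1.variance_target_mul_covariance memLp_act Y.continuous.measurable hlaw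
  rw [(h.moments hlam).2.2, h.var_act hlam] at channel
  rcases eq_or_ne (Var[target α β; μ]) 0 with hV | hV
  · have hVact : Var[act; μ] = 0 := by rw [h.var_act hlam, hV, mul_zero]
    rw [covariance_eq_zero_of_variance_eq_zero hY2 memLp_act hVact, infoFraction, hV, div_zero,
      zero_mul]
  · exact mul_left_cancel₀ hV (by linear_combination channel)

theorem IsOptimalSignal.cov_act_agg (h : IsOptimalSignal α β lam μ) (hlam : 0 < lam) :
    cov[act, agg; μ] = infoFraction α β μ * (α * Var[agg; μ] + β * cov[agg, state; μ]) := by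
  rw [covariance_comm agg, ← covariance_self measurable_agg.aemeasurable,
    ← covariance_target_left memLp_agg]
  exact h.cov_act hlam (.fst ℝ ℝ ℝ)

theorem IsOptimalSignal.cov_act_state (h : IsOptimalSignal α β lam μ) (hlam : 0 < lam) :
    cov[act, state; μ] = infoFraction α β μ * (α * cov[agg, state; μ] + β * Var[state; μ]) := by
  rw [← covariance_self measurable_state.aemeasurable, ← covariance_target_left memLp_state]
  exact h.cov_act hlam (.snd ℝ ℝ ℝ)

end OptimalMoments


section Fractions

variable {α β lam τ γ : ℝ}

/-- The variance of the target when the equilibrium aggregate action responds to a state of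
precision `τ` through the information fraction `γ`: the target then moves with slope
`β / (1 - α γ)` in the state. -/
noncomputable def targetVariance (α β τ γ : ℝ) : ℝ := β ^ 2 / (τ * (1 - α * γ) ^ 2)

/-- The self-consistent information fractions `γ`: the optimal signal about a target of variance
`targetVariance α β τ γ` has slope `γ`. They are the information fractions of equilibria. -/
def fractions (α β lam τ : ℝ) : Set ℝ := {γ | optimalSlope lam (targetVariance α β τ γ) = γ}

theorem one_sub_mul_pos (hα : α < 1) (h0 : 0 ≤ γ) (h1 : γ < 1) : 0 < 1 - α * γ := by
  nlinarith

theorem f_zero : f α β lam 0 = 2 * β ^ 2 / lam := by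
  simp [f]

theorem f_zero_pos (hβ : β ≠ 0) (hlam : 0 < lam) : 0 < f α β lam 0 := by
  rw [f_zero]
  positivity

theorem targetVariance_nonneg (hτ : 0 < τ) : 0 ≤ targetVariance α β τ γ := by
  unfold targetVariance
  positivity

theorem targetVariance_pos (hβ : β ≠ 0) (hτ : 0 < τ) (h : 0 < 1 - α * γ) :
    0 < targetVariance α β τ γ := by
  unfold targetVariance
  positivity

theorem targetVariance_mul_one_sub_eq_iff (hlam : 0 < lam) (hτ : 0 < τ) (h : 0 < 1 - α * γ) :
    targetVariance α β τ γ * (1 - γ) = lam / 2 ↔ τ = f α β lam γ := by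
  rw [targetVariance, f, ← mul_div_assoc, div_mul_eq_mul_div, div_mul_eq_mul_div, div_div,
    div_eq_div_iff (by positivity) two_ne_zero, eq_div_iff (by positivity)]
  constructor <;> intro h <;> linear_combination -h

theorem nonneg_of_mem_fractions (hτ : 0 < τ) (hγ : γ ∈ fractions α β lam τ) : 0 ≤ γ :=
  hγ ▸ optimalSlope_nonneg (targetVariance_nonneg hτ)

theorem lt_one_of_mem_fractions (hlam : 0 < lam) (hτ : 0 < τ) (hγ : γ ∈ fractions α β lam τ) :
    γ < 1 :=
  hγ ▸ optimalSlope_lt_one hlam (targetVariance_nonneg hτ)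

theorem zero_mem_fractions_iff (hβ : β ≠ 0) (hlam : 0 < lam) (hτ : 0 < τ) :
    0 ∈ fractions α β lam τ ↔ f α β lam 0 ≤ τ := by
  refine (optimalSlope_eq_zero_iff (targetVariance_pos hβ hτ (by simp))).trans ?_
  rw [f_zero, targetVariance, mul_zero, sub_zero, one_pow, mul_one, div_le_iff₀ hτ,
    div_le_iff₀ hlam]
  constructor <;> intro h <;> linarith

theorem lt_one_of_eq_f (hlam : 0 < lam) (hτ : 0 < τ) (h : τ = f α β lam γ) : γ < 1 := by
  by_contra! hγ
  refine hτ.not_ge (h.trans_le (mul_nonpos_of_nonneg_of_nonpos (by positivity) ?_))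
  exact div_nonpos_of_nonpos_of_nonneg (sub_nonpos.2 hγ) (sq_nonneg _)

theorem mem_fractions_iff_of_pos (hα : α < 1) (hβ : β ≠ 0) (hlam : 0 < lam) (hτ : 0 < τ)
    (hγ : 0 < γ) : γ ∈ fractions α β lam τ ↔ τ = f α β lam γ := by
  have iff_of_lt_one (h1 : γ < 1) : γ ∈ fractions α β lam τ ↔ τ = f α β lam γ := by
    have hpos := one_sub_mul_pos hα hγ.le h1
    exact (optimalSlope_eq_iff_of_pos (targetVariance_pos hβ hτ hpos) hγ).trans
      (targetVariance_mul_one_sub_eq_iff hlam hτ hpos)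
  exact ⟨fun h => (iff_of_lt_one (lt_one_of_mem_fractions hlam hτ h)).1 h,
    fun h => (iff_of_lt_one (lt_one_of_eq_f hlam hτ h)).2 h⟩

theorem eq_f_iff (hα : α < 1) (hlam : 0 < lam) (hτ : 0 < τ) (hγ : 0 < γ) :
    τ = f α β lam γ ↔ γ < 1 ∧ τ * (1 - α * γ) ^ 2 = f α β lam 0 * (1 - γ) := by
  have eq_iff_of_lt_one (h1 : γ < 1) :
      τ = f α β lam γ ↔ τ * (1 - α * γ) ^ 2 = f α β lam 0 * (1 - γ) := by
    have hpos := one_sub_mul_pos hα hγ.le h1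
    rw [f_zero, f, ← mul_div_assoc, eq_div_iff (by positivity)]
  exact ⟨fun h => ⟨lt_one_of_eq_f hlam hτ h, (eq_iff_of_lt_one (lt_one_of_eq_f hlam hτ h)).1 h⟩,
    fun h => (eq_iff_of_lt_one h.1).2 h.2⟩

end Fractions

section EquilibriumMoments

variable {α β lam τ m : ℝ} {μ : Measure Outcome}

theorem IsEquilibrium.infoFraction_nonneg (h : IsEquilibrium α β lam τ m μ) (hlam : 0 < lam) :
    0 ≤ infoFraction α β μ := by
  have := h.gaussian
  rw [h.optimal.infoFraction_eq hlam]
  exact optimalSlope_nonneg (variance_nonneg _ _)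

theorem IsEquilibrium.infoFraction_lt_one (h : IsEquilibrium α β lam τ m μ) (hlam : 0 < lam) :
    infoFraction α β μ < 1 := by
  have := h.gaussian
  rw [h.optimal.infoFraction_eq hlam]
  exact optimalSlope_lt_one hlam (variance_nonneg _ _)

theorem IsEquilibrium.one_sub_mul_infoFraction_pos (h : IsEquilibrium α β lam τ m μ)
    (hα : α < 1) (hlam : 0 < lam) : 0 < 1 - α * infoFraction α β μ :=
  one_sub_mul_pos hα (h.infoFraction_nonneg hlam) (h.infoFraction_lt_one hlam)

theorem IsEquilibrium.integral_act_agg (h : IsEquilibrium α β lam τ m μ) (hα : α < 1)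
    (hlam : 0 < lam) :
    ∫ ω, act ω ∂μ = β * m / (1 - α) ∧ ∫ ω, agg ω ∂μ = β * m / (1 - α) := by
  have := h.gaussian
  have fixed_point : ∫ ω, act ω ∂μ = α * ∫ ω, act ω ∂μ + β * m := by
    conv_lhs => rw [(h.optimal.moments hlam).1, integral_target, ← h.mean_eq, h.mean_state]
  have mean_act : ∫ ω, act ω ∂μ = β * m / (1 - α) := by
    rw [eq_div_iff (sub_pos.2 hα).ne']
    linear_combination fixed_point
  exact ⟨mean_act, h.mean_eq ▸ mean_act⟩

theorem IsEquilibrium.cov_agg_state_eq (h : IsEquilibrium α β lam τ m μ) (hα : α < 1)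
    (hlam : 0 < lam) :
    cov[agg, state; μ]
      = β * infoFraction α β μ / (1 - α * infoFraction α β μ) * Var[state; μ] := by
  have := h.gaussian
  have hpos := h.one_sub_mul_infoFraction_pos hα hlam
  rw [div_mul_eq_mul_div, eq_div_iff hpos.ne']
  linear_combination h.cov_state.trans (h.optimal.cov_act_state hlam)

theorem IsEquilibrium.var_agg_eq (h : IsEquilibrium α β lam τ m μ) (hα : α < 1)
    (hlam : 0 < lam) :
    Var[agg; μ]
      = (β * infoFraction α β μ / (1 - α * infoFraction α β μ)) ^ 2 * Var[state; μ] := by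
  have := h.gaussian
  have hpos := h.one_sub_mul_infoFraction_pos hα hlam
  rw [pow_two, mul_assoc, ← h.cov_agg_state_eq hα hlam, div_mul_eq_mul_div, eq_div_iff hpos.ne']
  linear_combination h.var_agg.trans (h.optimal.cov_act_agg hlam)

theorem IsEquilibrium.var_target_eq (h : IsEquilibrium α β lam τ m μ) (hα : α < 1)
    (hlam : 0 < lam) :
    Var[target α β; μ] = targetVariance α β τ (infoFraction α β μ) := by
  have := h.gaussian
  have hpos := h.one_sub_mul_infoFraction_pos hα hlam
  rw [variance_target, h.var_agg_eq hα hlam, h.cov_agg_state_eq hα hlam, h.var_state,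
    targetVariance]
  field_simp
  ring

theorem IsEquilibrium.infoFraction_mem_fractions (h : IsEquilibrium α β lam τ m μ) (hα : α < 1)
    (hlam : 0 < lam) : infoFraction α β μ ∈ fractions α β lam τ := by
  have := h.gaussian
  rw [fractions, Set.mem_ofPred_eq, ← h.var_target_eq hα hlam, ← h.optimal.infoFraction_eq hlam]

theorem IsEquilibrium.var_act_eq (h : IsEquilibrium α β lam τ m μ) (hα : α < 1) (hlam : 0 < lam) :
    Var[act; μ] = infoFraction α β μ * targetVariance α β τ (infoFraction α β μ) := by
  have := h.gaussian
  rw [h.optimal.var_act hlam, h.var_target_eq hα hlam]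

theorem injOn_infoFraction (hα : α < 1) (hlam : 0 < lam) :
    Set.InjOn (infoFraction α β) (equilibria α β lam τ m) := by
  intro μ hμ ν hν hγ
  have := hμ.gaussian
  have := hν.gaussian
  have var_state : Var[state; μ] = Var[state; ν] := hμ.var_state.trans hν.var_state.symm
  have var_agg : Var[agg; μ] = Var[agg; ν] := by
    rw [hμ.var_agg_eq hα hlam, hν.var_agg_eq hα hlam, hγ, var_state]
  have cov_agg_state : cov[agg, state; μ] = cov[agg, state; ν] := by
    rw [hμ.cov_agg_state_eq hα hlam, hν.cov_agg_state_eq hα hlam, hγ, var_state]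
  refine ext_of_moments ?_ ?_ (hμ.mean_state.trans hν.mean_state.symm) ?_ var_agg var_state
    (hμ.var_agg.symm.trans (var_agg.trans hν.var_agg))
    (hμ.cov_state.symm.trans (cov_agg_state.trans hν.cov_state)) cov_agg_state
  · rw [(hμ.integral_act_agg hα hlam).1, (hν.integral_act_agg hα hlam).1]
  · rw [(hμ.integral_act_agg hα hlam).2, (hν.integral_act_agg hα hlam).2]
  · rw [hμ.var_act_eq hα hlam, hν.var_act_eq hα hlam, hγ]

theorem IsEquilibrium.ae_agg_sub_mean_eq (h : IsEquilibrium α β lam τ m μ) (hα : α < 1)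
    (hlam : 0 < lam) :
    ∀ᵐ ω ∂μ, agg ω - ∫ ω', agg ω' ∂μ
      = β * infoFraction α β μ * (state ω - m) / (1 - α * infoFraction α β μ) := by
  have := h.gaussian
  set k := β * infoFraction α β μ / (1 - α * infoFraction α β μ) with hk
  have residual_memLp : MemLp (fun ω => agg ω - k * state ω) 2 μ :=
    memLp_agg.sub (memLp_state.const_mul k)
  have residual_variance : Var[fun ω => agg ω - k * state ω; μ] = 0 := by
    rw [variance_sub_mul memLp_agg memLp_state, covariance_comm, h.cov_agg_state_eq hα hlam,
      h.var_agg_eq hα hlam]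
    ring
  have residual_mean : ∫ ω, (agg ω - k * state ω) ∂μ = ∫ ω, agg ω ∂μ - k * m := by
    rw [integral_sub (memLp_agg.integrable one_le_two)
      ((memLp_state.integrable one_le_two).const_mul k), integral_const_mul, h.mean_state]
  filter_upwards [ae_eq_integral_of_variance_eq_zero residual_memLp residual_variance] with ω hω
  rw [residual_mean] at hω
  rw [mul_div_right_comm, ← hk]
  linear_combination hω

theorem IsEquilibrium.var_agg_eq_mul_var_act (h : IsEquilibrium α β lam τ m μ) (hα : α < 1)
    (hlam : 0 < lam) : Var[agg; μ] = infoFraction α β μ * Var[act; μ] := by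
  rw [h.var_act_eq hα hlam, h.var_agg_eq hα hlam, h.var_state, targetVariance, mul_comm τ,
    ← div_div, ← div_pow]
  ring

theorem IsEquilibrium.var_act_eq_of_eq_f (h : IsEquilibrium α β lam τ m μ) (hα : α < 1)
    (hlam : 0 < lam) (hτ : 0 < τ) (hf : τ = f α β lam (infoFraction α β μ)) :
    Var[act; μ] = lam * infoFraction α β μ / (2 * (1 - infoFraction α β μ)) := by
  have hlt := sub_pos.2 (h.infoFraction_lt_one hlam)
  have targetVariance_eq := (targetVariance_mul_one_sub_eq_iff hlam hτ
    (h.one_sub_mul_infoFraction_pos hα hlam)).2 hf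
  rw [h.var_act_eq hα hlam, eq_div_iff (by positivity)]
  linear_combination 2 * infoFraction α β μ * targetVariance_eq

theorem IsEquilibrium.cov_agg_state_eq_div (h : IsEquilibrium α β lam τ m μ) (hβ : β ≠ 0)
    (hlam : 0 < lam) : cov[agg, state; μ] = (Var[act; μ] - α * cov[act, agg; μ]) / β := by
  have := h.gaussian
  have cov_act_target : cov[act, target α β; μ] = Var[act; μ] := (h.optimal.moments hlam).2.2
  rw [covariance_comm, covariance_target_left memLp_act, covariance_comm agg,
    covariance_comm state, ← h.cov_state] at cov_act_target
  rw [eq_div_iff hβ]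
  linear_combination cov_act_target

end EquilibriumMoments

section Existence

variable {α β lam τ m γ : ℝ}

section AffineImage

variable {Ω : Type*} [MeasurableSpace Ω] {μ : Measure Ω} [IsProbabilityMeasure μ]
  {X Y Z : Ω → ℝ} {a k : ℝ}

theorem integral_eq_of_ae_eq_affine (hY : Integrable Y μ)
    (hXY : ∀ᵐ ω ∂μ, X ω = a + k * (Y ω - m)) : ∫ ω, X ω ∂μ = a + k * (∫ ω, Y ω ∂μ - m) := by
  have hYm : Integrable (fun ω => Y ω - m) μ := hY.sub (integrable_const m)
  rw [integral_congr_ae hXY, integral_add (integrable_const a) (hYm.const_mul k),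
    integral_const_mul, integral_sub hY (integrable_const m)]
  simp

theorem covariance_eq_mul_of_ae_eq_affine (hY : Integrable Y μ)
    (hXY : ∀ᵐ ω ∂μ, X ω = a + k * (Y ω - m)) : cov[X, Z; μ] = k * cov[Y, Z; μ] := by
  rw [covariance, covariance, ← integral_const_mul]
  refine integral_congr_ae (hXY.mono fun ω hω => ?_)
  simp only [hω, integral_eq_of_ae_eq_affine hY hXY]
  ring

end AffineImage

theorem isEquilibrium_of_agg_ae_eq {μ : Measure Outcome} [IsGaussian μ] (hα : α < 1)
    (hlam : 0 < lam) (hτ : 0 < τ) (hγ : γ ∈ fractions α β lam τ)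
    (optimal : IsOptimalSignal α β lam μ) (mean_state : ∫ ω, state ω ∂μ = m)
    (var_state : Var[state; μ] = 1 / τ)
    (hagg : ∀ᵐ ω ∂μ, agg ω = β * m / (1 - α) + β * γ / (1 - α * γ) * (state ω - m)) :
    IsEquilibrium α β lam τ m μ ∧ infoFraction α β μ = γ := by
  have hpos := one_sub_mul_pos hα (nonneg_of_mem_fractions hτ hγ)
    (lt_one_of_mem_fractions hlam hτ hγ)
  have integrable_state : Integrable state μ := memLp_state.integrable one_le_two
  set k := β * γ / (1 - α * γ) with hk
  have slope_eq : α * k + β = β / (1 - α * γ) := by rw [hk]; field_simp; ring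
  have k_eq : k = γ * (α * k + β) := by rw [slope_eq, hk]; ring
  have cov_agg_state : cov[agg, state; μ] = k * (1 / τ) := by
    rw [covariance_eq_mul_of_ae_eq_affine integrable_state hagg,
      covariance_self measurable_state.aemeasurable, var_state]
  have var_agg : Var[agg; μ] = k * (k * (1 / τ)) := by
    rw [← covariance_self measurable_agg.aemeasurable,
      covariance_eq_mul_of_ae_eq_affine integrable_state hagg, covariance_comm, cov_agg_state]
  have mean_agg : ∫ ω, agg ω ∂μ = β * m / (1 - α) := by
    rw [integral_eq_of_ae_eq_affine integrable_state hagg, mean_state, sub_self, mul_zero, add_zero]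
  have mean_act : ∫ ω, act ω ∂μ = β * m / (1 - α) := by
    rw [(optimal.moments hlam).1, integral_target, mean_agg, mean_state]
    field_simp [(sub_pos.2 hα).ne']
    ring
  have var_target : Var[target α β; μ] = targetVariance α β τ γ := by
    rw [variance_target, var_agg, cov_agg_state, var_state, targetVariance, mul_comm τ,
      ← div_div, ← div_pow, ← slope_eq]
    ring
  have infoFraction_eq : infoFraction α β μ = γ := by
    rw [optimal.infoFraction_eq hlam, var_target, hγ]
  refine ⟨⟨‹_›, mean_state, var_state, optimal, mean_act.trans mean_agg.symm, ?_, ?_⟩,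
    infoFraction_eq⟩
  · rw [optimal.cov_act_agg hlam, infoFraction_eq, var_agg, cov_agg_state]
    linear_combination k * (1 / τ) * k_eq
  · rw [optimal.cov_act_state hlam, infoFraction_eq, cov_agg_state, var_state]
    linear_combination 1 / τ * k_eq

theorem exists_isOptimalSignal_hasLaw_snd (hlam : 0 < lam) (ν : Measure (ℝ × ℝ)) [IsGaussian ν] :
    ∃ μ : Measure Outcome, IsGaussian μ ∧ IsOptimalSignal α β lam μ ∧ HasLaw Prod.snd ν μ := by
  have hT : HasGaussianLaw (targetFn α β) ν :=
    IsGaussian.hasGaussianLaw_id.map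
      (α • ContinuousLinearMap.fst ℝ ℝ ℝ + β • ContinuousLinearMap.snd ℝ ℝ ℝ)
  exact ⟨_, isGaussian_noisySignal, isOptimalSignal_optimalSignal hlam
    ⟨(measurable_targetFn α β).aemeasurable, hT.map_eq_gaussianReal⟩, hasLaw_snd_noisySignal⟩

theorem isGaussian_map_affine_prod (ρ : Measure ℝ) [IsGaussian ρ] (a k m : ℝ) :
    IsGaussian (ρ.map fun x => (a + k * (x - m), x)) := by
  have affine : (fun x : ℝ => (a + k * (x - m), x)) = (fun p => p + (a - k * m, 0)) ∘
      ((k • ContinuousLinearMap.id ℝ ℝ).prod (.id ℝ ℝ)) := by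
    ext x
    · simp only [Function.comp_apply, ContinuousLinearMap.prod_apply, Prod.fst_add,
        smul_apply, ContinuousLinearMap.id_apply, smul_eq_mul]
      ring
    · simp
  rw [affine, ← Measure.map_map (by fun_prop) (by fun_prop)]
  infer_instance

theorem exists_isEquilibrium_infoFraction_eq (hα : α < 1) (hlam : 0 < lam) (hτ : 0 < τ)
    (hγ : γ ∈ fractions α β lam τ) :
    ∃ μ ∈ equilibria α β lam τ m, infoFraction α β μ = γ := by
  set φ : ℝ → ℝ × ℝ := fun x => (β * m / (1 - α) + β * γ / (1 - α * γ) * (x - m), x)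
  have measurable_φ : Measurable φ := by fun_prop
  set ρ := gaussianReal m (1 / τ).toNNReal
  have : IsGaussian (ρ.map φ) := isGaussian_map_affine_prod ρ _ _ _
  obtain ⟨μ, _, optimal, hsnd⟩ :=
    exists_isOptimalSignal_hasLaw_snd (α := α) (β := β) hlam (ρ.map φ)
  have hstate : HasLaw state ρ μ := by
    refine HasLaw.comp (Y := Prod.snd) ⟨measurable_snd.aemeasurable, ?_⟩ hsnd
    rw [Measure.map_map measurable_snd measurable_φ]
    exact Measure.map_id
  have hagg : ∀ᵐ p ∂ρ.map φ, p.1 = (φ p.2).1 :=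
    (ae_map_iff measurable_φ.aemeasurable
      (measurableSet_eq_fun (by fun_prop) (by fun_prop))).2 (.of_forall fun _ => rfl)
  refine ⟨μ, isEquilibrium_of_agg_ae_eq hα hlam hτ hγ optimal ?_ ?_ ?_⟩
  · exact hstate.integral_eq.trans integral_id_gaussianReal
  · rw [hstate.variance_eq, variance_id_gaussianReal, Real.coe_toNNReal _ (by positivity)]
  · exact ae_of_ae_map hsnd.aemeasurable (hsnd.map_eq ▸ hagg)

end Existence

section Quadratic

variable {α c τ : ℝ}

/-- The roots in `(0, 1)` of the quadratic equation `τ (1 - α γ)² = c (1 - γ)`, which for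
`c = f α β lam 0` is the equation `τ = f α β lam γ` with its denominators cleared. -/
def interiorRoots (α c τ : ℝ) : Set ℝ :=
  {γ | 0 < γ ∧ γ < 1 ∧ τ * (1 - α * γ) ^ 2 = c * (1 - γ)}

theorem vieta {x y : ℝ} (hxy : x ≠ y) (hx : τ * (1 - α * x) ^ 2 = c * (1 - x))
    (hy : τ * (1 - α * y) ^ 2 = c * (1 - y)) :
    τ * α ^ 2 * (x + y) = 2 * α * τ - c ∧ τ * α ^ 2 * (x * y) = τ - c := by
  have sum_eq : τ * α ^ 2 * (x + y) = 2 * α * τ - c :=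
    mul_left_cancel₀ (sub_ne_zero.2 hxy) (by linear_combination hx - hy)
  exact ⟨sum_eq, by linear_combination x * sum_eq - hx⟩

theorem exists_root_mem_Ioo {a b : ℝ} (hab : a ≤ b)
    (h : (τ * (1 - α * a) ^ 2 < c * (1 - a) ∧ c * (1 - b) < τ * (1 - α * b) ^ 2) ∨
      (c * (1 - a) < τ * (1 - α * a) ^ 2 ∧ τ * (1 - α * b) ^ 2 < c * (1 - b))) :
    ∃ x ∈ Set.Ioo a b, τ * (1 - α * x) ^ 2 = c * (1 - x) := by
  have hcont : ContinuousOn (fun x => τ * (1 - α * x) ^ 2 - c * (1 - x)) (Set.Icc a b) := by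
    fun_prop
  rcases h with ⟨ha, hb⟩ | ⟨ha, hb⟩
  · obtain ⟨x, hx, h0⟩ := intermediate_value_Ioo hab hcont ⟨sub_neg.2 ha, sub_pos.2 hb⟩
    exact ⟨x, hx, sub_eq_zero.1 h0⟩
  · obtain ⟨x, hx, h0⟩ := intermediate_value_Ioo' hab hcont ⟨sub_neg.2 hb, sub_pos.2 ha⟩
    exact ⟨x, hx, sub_eq_zero.1 h0⟩

theorem encard_interiorRoots_of_lt (hα : α < 1) (hτ : 0 < τ) (h : τ < c) :
    (interiorRoots α c τ).encard = 1 := by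
  have at_one : 0 < τ * (1 - α) ^ 2 := by have := sub_pos.2 hα; positivity
  obtain ⟨x, ⟨hx0, hx1⟩, hx⟩ := exists_root_mem_Ioo (α := α) (τ := τ) (c := c) zero_le_one
    (.inl ⟨by simpa using h, by simpa using at_one⟩)
  refine Set.encard_eq_one.2 ⟨x, Set.Subset.antisymm (fun γ hγ => ?_) ?_⟩
  · by_contra hne
    have prod_eq := (vieta hne hγ.2.2 hx).2
    have prod_nonneg : 0 ≤ τ * α ^ 2 * (γ * x) := by have := hγ.1; positivity
    linarith
  · exact Set.singleton_subset_iff.2 ⟨hx0, hx1, hx⟩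

theorem interiorRoots_of_le_half (hα : α ≤ 1 / 2) (hc : 0 < c) (h : c ≤ τ) :
    interiorRoots α c τ = ∅ := by
  refine Set.eq_empty_of_forall_notMem fun γ ⟨h0, _, hγ⟩ => ?_
  have sq_le : (1 - α * γ) ^ 2 ≤ 1 - γ := by
    refine le_of_mul_le_mul_left ?_ hc
    exact (mul_le_mul_of_nonneg_right h (sq_nonneg _)).trans_eq hγ
  have le_zero : 1 - 2 * α + α ^ 2 * γ ≤ 0 :=
    le_of_mul_le_mul_left (by linarith : γ * (1 - 2 * α + α ^ 2 * γ) ≤ γ * 0) h0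
  rcases eq_or_ne α 0 with rfl | hα0
  · norm_num at le_zero
  · have : 0 < α ^ 2 * γ := by positivity
    linarith

theorem interiorRoots_of_discriminant_neg (hc : 0 < c) (h : c < 4 * α * (1 - α) * τ) :
    interiorRoots α c τ = ∅ := by
  refine Set.eq_empty_of_forall_notMem fun γ ⟨_, _, hγ⟩ => ?_
  have complete_square :
      (2 * τ * α ^ 2 * γ + c - 2 * α * τ) ^ 2 = c * (c - 4 * α * (1 - α) * τ) := by
    linear_combination 4 * τ * α ^ 2 * hγ
  exact (sq_nonneg _).not_gt (complete_square.trans_lt (mul_neg_of_pos_of_neg hc (sub_neg.2 h)))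

theorem encard_interiorRoots_self (hα : α < 1) (hα' : 1 / 2 < α) (hτ : τ ≠ 0) :
    (interiorRoots α τ τ).encard = 1 := by
  have : 0 < α := by linarith
  refine Set.encard_eq_one.2 ⟨(2 * α - 1) / α ^ 2, Set.Subset.antisymm (fun γ hγ => ?_) ?_⟩
  · obtain ⟨h0, _, hγ⟩ := hγ
    have linear_eq : γ * (γ * α ^ 2) = γ * (2 * α - 1) := by
      linear_combination mul_left_cancel₀ hτ hγ
    exact (eq_div_iff (by positivity)).2 (mul_left_cancel₀ h0.ne' linear_eq)
  · refine Set.singleton_subset_iff.2 ⟨div_pos (by linarith) (by positivity), ?_, ?_⟩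
    · rw [div_lt_one (by positivity)]
      linarith [pow_pos (sub_pos.2 hα) 2]
    · field_simp
      ring

theorem critical_mem_Ioo (hα : α < 1) (hα' : 1 / 2 < α) :
    (2 * α - 1) / α ∈ Set.Ioo (0 : ℝ) 1 := by
  have hα0 : 0 < α := by linarith
  exact ⟨div_pos (by linarith) hα0, (div_lt_one hα0).2 (by linarith)⟩

theorem encard_interiorRoots_of_discriminant_eq_zero (hα : α < 1) (hα' : 1 / 2 < α) (hτ : τ ≠ 0) :
    (interiorRoots α (4 * α * (1 - α) * τ) τ).encard = 1 := by
  have hα0 : 0 < α := by linarith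
  refine Set.encard_eq_one.2 ⟨(2 * α - 1) / α, Set.Subset.antisymm (fun γ hγ => ?_) ?_⟩
  · have square_eq_zero : τ * (γ * α - (2 * α - 1)) ^ 2 = 0 := by linear_combination hγ.2.2
    rw [mul_eq_zero, or_iff_right hτ, sq_eq_zero_iff, sub_eq_zero] at square_eq_zero
    exact (eq_div_iff hα0.ne').2 square_eq_zero
  · obtain ⟨h0, h1⟩ := critical_mem_Ioo hα hα'
    refine Set.singleton_subset_iff.2 ⟨h0, h1, ?_⟩
    field_simp
    ring

theorem encard_interiorRoots_of_discriminant_pos (hα : α < 1) (hα' : 1 / 2 < α) (hτ : 0 < τ)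
    (h : c < τ) (h' : 4 * α * (1 - α) * τ < c) : (interiorRoots α c τ).encard = 2 := by
  have hα0 : 0 < α := by linarith
  have h1α : 0 < 1 - α := sub_pos.2 hα
  obtain ⟨z_pos, z_lt_one⟩ := critical_mem_Ioo hα hα'
  set z := (2 * α - 1) / α with hz
  have at_z : τ * (1 - α * z) ^ 2 < c * (1 - z) := by
    have one_sub_mul_z : 1 - α * z = 2 * (1 - α) := by rw [hz]; field_simp; ring
    have one_sub_z : 1 - z = (1 - α) / α := by rw [hz]; field_simp; ring
    rw [one_sub_mul_z, one_sub_z, ← mul_div_assoc, lt_div_iff₀ hα0]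
    linarith [mul_lt_mul_of_pos_right h' h1α]
  have at_one : 0 < τ * (1 - α) ^ 2 := by positivity
  obtain ⟨x, ⟨hx0, hxz⟩, hx⟩ := exists_root_mem_Ioo z_pos.le (.inr ⟨by simpa using h, at_z⟩)
  obtain ⟨y, ⟨hzy, hy1⟩, hy⟩ := exists_root_mem_Ioo z_lt_one.le
    (.inl ⟨at_z, by simpa using at_one⟩)
  have hxy : x < y := hxz.trans hzy
  refine Set.encard_eq_two.2 ⟨x, y, hxy.ne, Set.Subset.antisymm (fun γ hγ => ?_) ?_⟩
  · by_contra hne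
    obtain ⟨hγx, hγy⟩ := not_or.1 hne
    have sum_eq : τ * α ^ 2 * (γ + x) = τ * α ^ 2 * (γ + y) :=
      (vieta hγx hγ.2.2 hx).1.trans (vieta hγy hγ.2.2 hy).1.symm
    exact hxy.ne (add_left_cancel (mul_left_cancel₀ (by positivity) sum_eq))
  · exact Set.pair_subset ⟨hx0, hxy.trans hy1, hx⟩ ⟨hx0.trans hxy, hy1, hy⟩

end Quadratic

section Counting

variable {α β lam τ m : ℝ}

theorem fractions_inter_Ioi (hα : α < 1) (hβ : β ≠ 0) (hlam : 0 < lam) (hτ : 0 < τ) :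
    fractions α β lam τ ∩ Set.Ioi 0 = interiorRoots α (f α β lam 0) τ := by
  ext γ
  rw [Set.mem_inter_iff, and_comm]
  exact and_congr_right fun h0 =>
    (mem_fractions_iff_of_pos hα hβ hlam hτ h0).trans (eq_f_iff hα hlam hτ h0)

theorem fractions_of_lt (hα : α < 1) (hβ : β ≠ 0) (hlam : 0 < lam) (hτ : 0 < τ)
    (h : τ < f α β lam 0) : fractions α β lam τ = interiorRoots α (f α β lam 0) τ := by
  rw [← fractions_inter_Ioi hα hβ hlam hτ, eq_comm, Set.inter_eq_left]
  refine fun γ hγ => (nonneg_of_mem_fractions hτ hγ).lt_of_ne ?_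
  rintro rfl
  exact h.not_ge ((zero_mem_fractions_iff hβ hlam hτ).1 hγ)

theorem fractions_of_le (hα : α < 1) (hβ : β ≠ 0) (hlam : 0 < lam) (hτ : 0 < τ)
    (h : f α β lam 0 ≤ τ) :
    fractions α β lam τ = insert 0 (interiorRoots α (f α β lam 0) τ) := by
  rw [← fractions_inter_Ioi hα hβ hlam hτ]
  refine Set.Subset.antisymm (fun γ hγ => ?_)
    (Set.insert_subset ((zero_mem_fractions_iff hβ hlam hτ).2 h) Set.inter_subset_left)
  exact (nonneg_of_mem_fractions hτ hγ).eq_or_lt.imp Eq.symm fun h0 => ⟨hγ, h0⟩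

theorem f_critical (hα : α < 1) (hα' : 1 / 2 < α) :
    f α β lam ((2 * α - 1) / α) = f α β lam 0 / (4 * α * (1 - α)) := by
  have : 0 < α := by linarith
  have one_sub_mul : 1 - α * ((2 * α - 1) / α) = 2 * (1 - α) := by field_simp; ring
  have h1α : 0 < 1 - α := sub_pos.2 hα
  rw [f_zero, f, one_sub_mul]
  field_simp
  ring

theorem f_zero_lt_f_critical (hα : α < 1) (hα' : 1 / 2 < α) (hβ : β ≠ 0) (hlam : 0 < lam) :
    f α β lam 0 < f α β lam ((2 * α - 1) / α) := by
  have : 0 < α := by linarith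
  have : 0 < 1 - α := sub_pos.2 hα
  have lt_one : 4 * α * (1 - α) < 1 := by
    linarith [pow_pos (show 0 < 2 * α - 1 by linarith) 2]
  rw [f_critical hα hα', lt_div_iff₀ (by positivity)]
  exact mul_lt_of_lt_one_right (f_zero_pos hβ hlam) lt_one

theorem image_infoFraction (hα : α < 1) (hlam : 0 < lam) (hτ : 0 < τ) :
    infoFraction α β '' equilibria α β lam τ m = fractions α β lam τ :=
  Set.Subset.antisymm
    (Set.image_subset_iff.2 fun _ hμ => hμ.infoFraction_mem_fractions hα hlam)
    fun _ => exists_isEquilibrium_infoFraction_eq hα hlam hτ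

theorem encard_equilibria (hα : α < 1) (hlam : 0 < lam) (hτ : 0 < τ) :
    (equilibria α β lam τ m).encard = (fractions α β lam τ).encard := by
  rw [← image_infoFraction (m := m) hα hlam hτ, (injOn_infoFraction hα hlam).encard_image]

theorem exists_infoFraction_eq_iff (hα : α < 1) (hlam : 0 < lam) (hτ : 0 < τ) {γ : ℝ} :
    (∃ μ ∈ equilibria α β lam τ m, infoFraction α β μ = γ) ↔ γ ∈ fractions α β lam τ := by
  rw [← image_infoFraction (m := m) hα hlam hτ, Set.mem_image]

theorem exists_infoFraction_pos_iff (hα : α < 1) (hβ : β ≠ 0) (hlam : 0 < lam) (hτ : 0 < τ) :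
    (∃ μ ∈ equilibria α β lam τ m, 0 < infoFraction α β μ) ↔
      ∃ γ, 0 < γ ∧ τ = f α β lam γ := by
  constructor
  · rintro ⟨μ, hμ, h0⟩
    exact ⟨_, h0, (mem_fractions_iff_of_pos hα hβ hlam hτ h0).1
      (hμ.infoFraction_mem_fractions hα hlam)⟩
  · rintro ⟨γ, h0, hf⟩
    obtain ⟨μ, hμ, rfl⟩ := (exists_infoFraction_eq_iff hα hlam hτ).2
      ((mem_fractions_iff_of_pos hα hβ hlam hτ h0).2 hf)
    exact ⟨μ, hμ, h0⟩

theorem equilibria_of_lt (hα : α < 1) (hβ : β ≠ 0) (hlam : 0 < lam) (hτ : 0 < τ)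
    (h : τ < f α β lam 0) :
    (equilibria α β lam τ m).encard = 1 ∧
      ∀ μ ∈ equilibria α β lam τ m, 0 < infoFraction α β μ := by
  have fractions_eq := fractions_of_lt hα hβ hlam hτ h
  refine ⟨?_, fun μ hμ => ?_⟩
  · rw [encard_equilibria hα hlam hτ, fractions_eq, encard_interiorRoots_of_lt hα hτ h]
  · have mem_roots := hμ.infoFraction_mem_fractions hα hlam
    rw [fractions_eq] at mem_roots
    exact mem_roots.1

theorem equilibria_of_interiorRoots_eq_empty (hα : α < 1) (hβ : β ≠ 0) (hlam : 0 < lam)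
    (hτ : 0 < τ) (h : f α β lam 0 ≤ τ) (hroots : interiorRoots α (f α β lam 0) τ = ∅) :
    (equilibria α β lam τ m).encard = 1 ∧
      ∀ μ ∈ equilibria α β lam τ m, infoFraction α β μ = 0 := by
  have fractions_eq : fractions α β lam τ = {0} := by
    rw [fractions_of_le hα hβ hlam hτ h, hroots, insert_empty_eq]
  refine ⟨by rw [encard_equilibria hα hlam hτ, fractions_eq, Set.encard_singleton], ?_⟩
  exact fun μ hμ => (fractions_eq ▸ hμ.infoFraction_mem_fractions hα hlam :)

theorem equilibria_of_le_half (hα : α ≤ 1 / 2) (hβ : β ≠ 0) (hlam : 0 < lam) (hτ : 0 < τ)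
    (h : f α β lam 0 ≤ τ) :
    (equilibria α β lam τ m).encard = 1 ∧
      ∀ μ ∈ equilibria α β lam τ m, infoFraction α β μ = 0 :=
  equilibria_of_interiorRoots_eq_empty (by linarith) hβ hlam hτ h
    (interiorRoots_of_le_half hα (f_zero_pos hβ hlam) h)

theorem equilibria_of_f_critical_lt (hα : α < 1) (hα' : 1 / 2 < α) (hβ : β ≠ 0) (hlam : 0 < lam)
    (hτ : 0 < τ) (h : f α β lam ((2 * α - 1) / α) < τ) :
    (equilibria α β lam τ m).encard = 1 ∧
      ∀ μ ∈ equilibria α β lam τ m, infoFraction α β μ = 0 := by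
  have hα0 : 0 < α := by linarith
  have h1α : 0 < 1 - α := sub_pos.2 hα
  refine equilibria_of_interiorRoots_eq_empty hα hβ hlam hτ
    ((f_zero_lt_f_critical hα hα' hβ hlam).trans h).le
    (interiorRoots_of_discriminant_neg (f_zero_pos hβ hlam) ?_)
  rwa [f_critical hα hα', div_lt_iff₀' (by positivity)] at h

theorem equilibria_of_le (hα : α < 1) (hβ : β ≠ 0) (hlam : 0 < lam) (hτ : 0 < τ)
    (h : f α β lam 0 ≤ τ) :
    (equilibria α β lam τ m).encard = (interiorRoots α (f α β lam 0) τ).encard + 1 ∧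
      ∃! μ, μ ∈ equilibria α β lam τ m ∧ infoFraction α β μ = 0 := by
  constructor
  · rw [encard_equilibria hα hlam hτ, fractions_of_le hα hβ hlam hτ h,
      Set.encard_insert_of_notMem fun h0 => lt_irrefl 0 h0.1]
  · obtain ⟨μ, hμ, h0⟩ := (exists_infoFraction_eq_iff (m := m) hα hlam hτ).2
      ((zero_mem_fractions_iff hβ hlam hτ).2 h)
    exact ⟨μ, ⟨hμ, h0⟩, fun ν hν =>
      injOn_infoFraction hα hlam hν.1 hμ (hν.2.trans h0.symm)⟩

theorem equilibria_of_eq_f_zero_or_eq_f_critical (hα : α < 1) (hα' : 1 / 2 < α) (hβ : β ≠ 0)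
    (hlam : 0 < lam) (hτ : 0 < τ)
    (h : τ = f α β lam 0 ∨ τ = f α β lam ((2 * α - 1) / α)) :
    (equilibria α β lam τ m).encard = 2 ∧
      ∃! μ, μ ∈ equilibria α β lam τ m ∧ infoFraction α β μ = 0 := by
  have : 0 < α := by linarith
  have : 0 < 1 - α := sub_pos.2 hα
  have f_zero_le : f α β lam 0 ≤ τ := by
    rcases h with h | h
    · exact h.ge
    · exact h ▸ (f_zero_lt_f_critical hα hα' hβ hlam).le
  have encard_roots : (interiorRoots α (f α β lam 0) τ).encard = 1 := by
    rcases h with h | h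
    · rw [← h, encard_interiorRoots_self hα hα' hτ.ne']
    · rw [f_critical hα hα', eq_div_iff (by positivity), mul_comm] at h
      rw [← h, encard_interiorRoots_of_discriminant_eq_zero hα hα' hτ.ne']
  refine (equilibria_of_le hα hβ hlam hτ f_zero_le).imp_left fun encard_eq => ?_
  rw [encard_eq, encard_roots, one_add_one_eq_two]

theorem equilibria_of_f_zero_lt_of_lt_f_critical (hα : α < 1) (hα' : 1 / 2 < α) (hβ : β ≠ 0)
    (hlam : 0 < lam) (hτ : 0 < τ) (h : f α β lam 0 < τ)
    (h' : τ < f α β lam ((2 * α - 1) / α)) :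
    (equilibria α β lam τ m).encard = 3 ∧
      ∃! μ, μ ∈ equilibria α β lam τ m ∧ infoFraction α β μ = 0 := by
  have hα0 : 0 < α := by linarith
  have h1α : 0 < 1 - α := sub_pos.2 hα
  rw [f_critical hα hα', lt_div_iff₀' (by positivity)] at h'
  refine (equilibria_of_le hα hβ hlam hτ h.le).imp_left fun encard_eq => ?_
  rw [encard_eq, encard_interiorRoots_of_discriminant_pos hα hα' hτ h h', two_add_one_eq_three]

end Counting

section SecondMoments

variable {α β lam τ m : ℝ} {μ : Measure Outcome}

theorem IsEquilibrium.second_moments (h : IsEquilibrium α β lam τ m μ) (hα : α < 1)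
    (hβ : β ≠ 0) (hlam : 0 < lam) (hτ : 0 < τ) {γ : ℝ} (hγ : γ = infoFraction α β μ)
    (hf : τ = f α β lam γ) :
    (∀ᵐ ω ∂μ, agg ω - ∫ ω', agg ω' ∂μ = β * γ * (state ω - m) / (1 - α * γ)) ∧
      Var[act; μ] = lam * γ / (2 * (1 - γ)) ∧
      cov[act, agg; μ] = Var[agg; μ] ∧
      Var[agg; μ] = γ * Var[act; μ] ∧
      γ * Var[act; μ] = lam * γ ^ 2 / (2 * (1 - γ)) ∧
      cov[act, state; μ] = cov[agg, state; μ] ∧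
      cov[agg, state; μ] = (Var[act; μ] - α * cov[act, agg; μ]) / β ∧
      (Var[act; μ] - α * cov[act, agg; μ]) / β
        = lam * γ * (1 - α * γ) / (2 * β * (1 - γ)) := by
  subst hγ
  have var_act := h.var_act_eq_of_eq_f hα hlam hτ hf
  have var_agg := h.var_agg_eq_mul_var_act hα hlam
  refine ⟨h.ae_agg_sub_mean_eq hα hlam, var_act, h.var_agg.symm, var_agg, ?_,
    h.cov_state.symm, h.cov_agg_state_eq_div hβ hlam, ?_⟩
  · rw [var_act]
    ring
  · have hlt := sub_pos.2 (h.infoFraction_lt_one hlam)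
    rw [← h.var_agg, var_agg, var_act]
    field_simp

end SecondMoments

end LQG

theorem mainTheorem1_general (α β lam τ m : ℝ) (hα : α < 1) (hβ : β ≠ 0) (hlam : 0 < lam)
    (hτ : 0 < τ) :
    (∀ γ : ℝ, 0 < γ →
      ((∃ μ ∈ LQG.equilibria α β lam τ m, LQG.infoFraction α β μ = γ) ↔
        τ = LQG.f α β lam γ)) ∧
    ((∃ μ ∈ LQG.equilibria α β lam τ m, 0 < LQG.infoFraction α β μ) ↔
      ∃ γ : ℝ, 0 < γ ∧ τ = LQG.f α β lam γ) ∧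
    ((∃ μ ∈ LQG.equilibria α β lam τ m, LQG.infoFraction α β μ = 0) ↔
      LQG.f α β lam 0 ≤ τ) ∧
    (α ≤ 1 / 2 →
      (LQG.equilibria α β lam τ m).encard = 1 ∧
      (τ < LQG.f α β lam 0 →
        ∀ μ ∈ LQG.equilibria α β lam τ m, 0 < LQG.infoFraction α β μ) ∧
      (LQG.f α β lam 0 ≤ τ →
        ∀ μ ∈ LQG.equilibria α β lam τ m, LQG.infoFraction α β μ = 0)) ∧
    (1 / 2 < α →
      (τ < LQG.f α β lam 0 →
        (LQG.equilibria α β lam τ m).encard = 1 ∧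
        ∀ μ ∈ LQG.equilibria α β lam τ m, 0 < LQG.infoFraction α β μ) ∧
      (LQG.f α β lam ((2 * α - 1) / α) < τ →
        (LQG.equilibria α β lam τ m).encard = 1 ∧
        ∀ μ ∈ LQG.equilibria α β lam τ m, LQG.infoFraction α β μ = 0) ∧
      (τ = LQG.f α β lam 0 ∨ τ = LQG.f α β lam ((2 * α - 1) / α) →
        (LQG.equilibria α β lam τ m).encard = 2 ∧
        ∃! μ, μ ∈ LQG.equilibria α β lam τ m ∧ LQG.infoFraction α β μ = 0) ∧
      (LQG.f α β lam 0 < τ → τ < LQG.f α β lam ((2 * α - 1) / α) →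
        (LQG.equilibria α β lam τ m).encard = 3 ∧
        ∃! μ, μ ∈ LQG.equilibria α β lam τ m ∧ LQG.infoFraction α β μ = 0)) ∧
    (∀ μ ∈ LQG.equilibria α β lam τ m,
      ∫ ω, LQG.act ω ∂μ = β * m / (1 - α) ∧ ∫ ω, LQG.agg ω ∂μ = β * m / (1 - α)) ∧
    (∀ μ ∈ LQG.equilibria α β lam τ m, ∀ γ : ℝ, γ = LQG.infoFraction α β μ →
      τ = LQG.f α β lam γ →
      (∀ᵐ ω ∂μ, LQG.agg ω - ∫ ω', LQG.agg ω' ∂μ =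
        β * γ * (LQG.state ω - m) / (1 - α * γ)) ∧
      Var[LQG.act; μ] = lam * γ / (2 * (1 - γ)) ∧
      cov[LQG.act, LQG.agg; μ] = Var[LQG.agg; μ] ∧
      Var[LQG.agg; μ] = γ * Var[LQG.act; μ] ∧
      γ * Var[LQG.act; μ] = lam * γ ^ 2 / (2 * (1 - γ)) ∧
      cov[LQG.act, LQG.state; μ] = cov[LQG.agg, LQG.state; μ] ∧
      cov[LQG.agg, LQG.state; μ] =
        (Var[LQG.act; μ] - α * cov[LQG.act, LQG.agg; μ]) / β ∧
      (Var[LQG.act; μ] - α * cov[LQG.act, LQG.agg; μ]) / β =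
        lam * γ * (1 - α * γ) / (2 * β * (1 - γ))) := by
  have low (h : τ < LQG.f α β lam 0) := LQG.equilibria_of_lt (m := m) hα hβ hlam hτ h
  refine ⟨fun γ hγ => ?_, LQG.exists_infoFraction_pos_iff hα hβ hlam hτ, ?_, fun hα' => ?_,
    fun hα' => ⟨low, LQG.equilibria_of_f_critical_lt hα hα' hβ hlam hτ,
      LQG.equilibria_of_eq_f_zero_or_eq_f_critical hα hα' hβ hlam hτ,
      LQG.equilibria_of_f_zero_lt_of_lt_f_critical hα hα' hβ hlam hτ⟩,
    fun μ hμ => hμ.integral_act_agg hα hlam,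
    fun μ hμ γ hγ hf => hμ.second_moments hα hβ hlam hτ hγ hf⟩
  · exact (LQG.exists_infoFraction_eq_iff hα hlam hτ).trans
      (LQG.mem_fractions_iff_of_pos hα hβ hlam hτ hγ)
  · exact (LQG.exists_infoFraction_eq_iff hα hlam hτ).trans
      (LQG.zero_mem_fractions_iff hβ hlam hτ)
  · have high (h : LQG.f α β lam 0 ≤ τ) :=
      LQG.equilibria_of_le_half (m := m) hα' hβ hlam hτ h
    exact ⟨(lt_or_ge τ (LQG.f α β lam 0)).elim (fun h => (low h).1) fun h => (high h).1,
      fun h => (low h).2, fun h => (high h).2⟩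

theorem mainTheorem1 (α β lam τ m : ℝ) (hα : α < 1) (hβ : 0 < β) (hlam : 0 < lam) (hτ : 0 < τ) :
    -- equilibria with positive information fraction
    (∀ γ : ℝ, 0 < γ →
      ((∃ μ ∈ LQG.equilibria α β lam τ m, LQG.infoFraction α β μ = γ) ↔
        τ = LQG.f α β lam γ)) ∧
    ((∃ μ ∈ LQG.equilibria α β lam τ m, 0 < LQG.infoFraction α β μ) ↔
      ∃ γ : ℝ, 0 < γ ∧ τ = LQG.f α β lam γ) ∧
    -- equilibria with information fraction zero
    ((∃ μ ∈ LQG.equilibria α β lam τ m, LQG.infoFraction α β μ = 0) ↔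
      LQG.f α β lam 0 ≤ τ) ∧
    -- (i)
    (α ≤ 1 / 2 →
      (LQG.equilibria α β lam τ m).encard = 1 ∧
      (τ < LQG.f α β lam 0 →
        ∀ μ ∈ LQG.equilibria α β lam τ m, 0 < LQG.infoFraction α β μ) ∧
      (LQG.f α β lam 0 ≤ τ →
        ∀ μ ∈ LQG.equilibria α β lam τ m, LQG.infoFraction α β μ = 0)) ∧
    -- (ii)
    (1 / 2 < α →
      (τ < LQG.f α β lam 0 →
        (LQG.equilibria α β lam τ m).encard = 1 ∧
        ∀ μ ∈ LQG.equilibria α β lam τ m, 0 < LQG.infoFraction α β μ) ∧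
      (LQG.f α β lam ((2 * α - 1) / α) < τ →
        (LQG.equilibria α β lam τ m).encard = 1 ∧
        ∀ μ ∈ LQG.equilibria α β lam τ m, LQG.infoFraction α β μ = 0) ∧
      (τ = LQG.f α β lam 0 ∨ τ = LQG.f α β lam ((2 * α - 1) / α) →
        (LQG.equilibria α β lam τ m).encard = 2 ∧
        ∃! μ, μ ∈ LQG.equilibria α β lam τ m ∧ LQG.infoFraction α β μ = 0) ∧
      (LQG.f α β lam 0 < τ → τ < LQG.f α β lam ((2 * α - 1) / α) →
        (LQG.equilibria α β lam τ m).encard = 3 ∧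
        ∃! μ, μ ∈ LQG.equilibria α β lam τ m ∧ LQG.infoFraction α β μ = 0)) ∧
    -- means
    (∀ μ ∈ LQG.equilibria α β lam τ m,
      ∫ ω, LQG.act ω ∂μ = β * m / (1 - α) ∧ ∫ ω, LQG.agg ω ∂μ = β * m / (1 - α)) ∧
    -- second moments
    (∀ μ ∈ LQG.equilibria α β lam τ m, ∀ γ : ℝ, γ = LQG.infoFraction α β μ →
      τ = LQG.f α β lam γ →
      (∀ᵐ ω ∂μ, LQG.agg ω - ∫ ω', LQG.agg ω' ∂μ =
        β * γ * (LQG.state ω - m) / (1 - α * γ)) ∧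
      Var[LQG.act; μ] = lam * γ / (2 * (1 - γ)) ∧
      cov[LQG.act, LQG.agg; μ] = Var[LQG.agg; μ] ∧
      Var[LQG.agg; μ] = γ * Var[LQG.act; μ] ∧
      γ * Var[LQG.act; μ] = lam * γ ^ 2 / (2 * (1 - γ)) ∧
      cov[LQG.act, LQG.state; μ] = cov[LQG.agg, LQG.state; μ] ∧
      cov[LQG.agg, LQG.state; μ] =
        (Var[LQG.act; μ] - α * cov[LQG.act, LQG.agg; μ]) / β ∧
      (Var[LQG.act; μ] - α * cov[LQG.act, LQG.agg; μ]) / β =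
        lam * γ * (1 - α * γ) / (2 * β * (1 - γ))) :=
  mainTheorem1_general α β lam τ m hα hβ.ne' hlam hτ
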